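/- All operads are unital nonsymmetric operads in $\mathbb{Z}$-graded abelian groups, with homological degrees and Koszul signs; $x\circ_i y$ denotes partial composition. In a dg operad the differential $d$ has degree $-1$, satisfies $d^2=0$, and is a derivation: $d(x\circ_i y)=dx\circ_i y+(-1)^{|x|}x\circ_i dy$. Let $[\kappa]$ be the operad freely generated by one operation $\kappa$ of arity $0$ and degree $-1$. For an operad $P$, the coproduct $P\vee[\kappa]$ carries a weight grading, given by the number of occurrences of $\kappa$ in an expression. Let $\operatorname{Curv}$ be the following category. Its objects are quadruples $(Q,d,\kappa,Q_0)$, where $(Q,d)$ is a dg operad, $Q_0$ is a suboperad of the underlying graded operad $Q$ (not necessarily closed under $d$), and $\kappa\in Q\setminus Q_0$ is an operation of arity $0$ and degree $-1$, such that 1. the natural morphism $Q_0\vee[\kappa]\to Q$ is an isomorphism of graded operads; 2. with respect to the resulting weight grading $Q=\bigoplus_{j\ge 0}Q_j$, the differential is $d=d_0+d_1$ with $d_0(Q_j)\subset Q_j$ and $d_1(Q_j)\subset Q_{j+1}$ for all $j$; 3. $d_1\kappa=0$. A morphism $(Q,d,\kappa,Q_0)\to(Q',d',\kappa',Q_0')$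 is a morphism of dg operads $f:(Q,d)\to(Q',d')$ with $f(\kappa)=\kappa'$ and $f(Q_0)\subset Q_0'$. Let $\mathrm{cA}_\infty$ be the (shifted) curved $A_\infty$ operad: the free operad on operations $\mu_n$, $n\ge 0$, of arity $n$ and degree $-1$, with the differential determined by $$d\mu_n=-\sum_{\substack{p+q+r=n\\ p,q,r\ge 0}}\mu_{p+1+r}\circ_{p+1}\mu_q .$$ Let $\langle\mu_i\rangle_{i>0}\subset\mathrm{cA}_\infty$ be the suboperad generated by the $\mu_i$ with $i>0$. **Theorem.** The quadruple $(\mathrm{cA}_\infty,d,\mu_0,\langle\mu_i\rangle_{i>0})$ is an object of $\operatorname{Curv}$, and it is the initial object of $\operatorname{Curv}$. -/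

import Mathlib

open CategoryTheory

universe u

namespace CurvedOperad

/-- The Koszul sign `(-1)^e`, as an integer. -/
def ksign (e : ℤ) : ℤ := (e.negOnePow : ℤ)

theorem ksign_add (e f : ℤ) : ksign (e + f) = ksign e * ksign f := by
  simp [ksign, Int.negOnePow_add]

theorem ksign_mul_self (e : ℤ) : ksign e * ksign e = 1 := by
  unfold ksign
  rw [← Units.val_mul, Int.units_mul_self, Units.val_one]

theorem ksign_neg_one : ksign (-1) = -1 := by
  simp [ksign, Int.negOnePow_neg]

/-- A (unital) nonsymmetric operad in `ℤ`-graded abelian groups, presented by partial compositions.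
`obj n a` is the group of operations of arity `n` and homological degree `a`.
`comp i x y` is the partial composition `x ∘_{i+1} y` (inputs are numbered from `0`); the arity `k`
and degree `c` of the composite are tied to those of `x` and `y` by the equations
`m + n = k + 1` and `a + b = c`. -/
structure GrOperad where
  obj : ℕ → ℤ → Type u
  [grp : ∀ n a, AddCommGroup (obj n a)]
  one : obj 1 0
  comp : ∀ {m n k : ℕ} {a b c : ℤ} (i : ℕ), i < m → m + n = k + 1 → a + b = c →
    (obj m a →+ obj n b →+ obj k c)
  one_comp : ∀ {n : ℕ} {b : ℤ} (y : obj n b),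
    comp 0 Nat.one_pos (Nat.add_comm 1 n) (zero_add b) one y = y
  comp_one : ∀ {m : ℕ} {a : ℤ} (i : ℕ) (hi : i < m) (x : obj m a),
    comp i hi rfl (add_zero a) x one = x
  /-- Sequential composition: `(x ∘_i y) ∘_{i+j} z = x ∘_i (y ∘_j z)`. -/
  comp_assoc : ∀ {m n p k l r : ℕ} {a b c e f g : ℤ} (i j : ℕ) (hi : i < m) (hj : j < n)
    (hij : i + j < k) (hk : m + n = k + 1) (hr : k + p = r + 1)
    (hl : n + p = l + 1) (hr' : m + l = r + 1)
    (he : a + b = e) (hg : e + c = g) (hf : b + c = f) (hg' : a + f = g)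
    (x : obj m a) (y : obj n b) (z : obj p c),
    comp (i + j) hij hr hg (comp i hi hk he x y) z = comp i hi hr' hg' x (comp j hj hl hf y z)
  /-- Parallel composition: for inputs `i < j` of `x`,
  `(x ∘_i y) ∘_{j + n - 1} z = (-1)^{|y||z|} (x ∘_j z) ∘_i y`. -/
  comp_parallel : ∀ {m n p k l r : ℕ} {a b c e f g : ℤ} (i j j' : ℕ) (_ : i < j)
    (hi : i < m) (hj : j < m) (_ : j + n = j' + 1) (hjk : j' < k) (hil : i < l)
    (hk : m + n = k + 1) (hr : k + p = r + 1) (hl : m + p = l + 1) (hr' : l + n = r + 1)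
    (he : a + b = e) (hg : e + c = g) (hf : a + c = f) (hg' : f + b = g)
    (x : obj m a) (y : obj n b) (z : obj p c),
    comp j' hjk hr hg (comp i hi hk he x y) z =
      ksign (b * c) • comp i hil hr' hg' (comp j hj hl hf x z) y

attribute [instance] GrOperad.grp

/-- Morphisms of graded operads. -/
@[ext]
structure GrOperad.Hom (P Q : GrOperad.{u}) where
  map : ∀ {n : ℕ} {a : ℤ}, P.obj n a →+ Q.obj n a
  map_one : map P.one = Q.one
  map_comp : ∀ {m n k : ℕ} {a b c : ℤ} (i : ℕ) (hi : i < m) (hk : m + n = k + 1) (hc : a + b = c)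
    (x : P.obj m a) (y : P.obj n b),
    map (P.comp i hi hk hc x y) = Q.comp i hi hk hc (map x) (map y)

instance : Category GrOperad.{u} where
  Hom := GrOperad.Hom
  id P :=
    { map := AddMonoidHom.id _
      map_one := rfl
      map_comp := fun _ _ _ _ _ _ => rfl }
  comp f g :=
    { map := g.map.comp f.map
      map_one := by simp [f.map_one, g.map_one]
      map_comp := by intros; simp [f.map_comp, g.map_comp] }

/-- Sub-operads of a graded operad (closed under the group structure, the identity operation and
partial composition, spanned by homogeneous elements). -/
structure SubOperad (Q : GrOperad.{u}) where
  carrier : ∀ (n : ℕ) (a : ℤ), AddSubgroup (Q.obj n a)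
  one_mem : Q.one ∈ carrier 1 0
  comp_mem : ∀ {m n k : ℕ} {a b c : ℤ} (i : ℕ) (hi : i < m) (hk : m + n = k + 1) (hc : a + b = c)
    {x : Q.obj m a} {y : Q.obj n b}, x ∈ carrier m a → y ∈ carrier n b →
    Q.comp i hi hk hc x y ∈ carrier k c

/-- A sub-operad, as an operad. -/
def SubOperad.toOperad {Q : GrOperad.{u}} (S : SubOperad Q) : GrOperad.{u} where
  obj n a := S.carrier n a
  one := ⟨Q.one, S.one_mem⟩
  comp i hi hk hc := AddMonoidHom.mk' (fun x => AddMonoidHom.mk'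
      (fun y => ⟨Q.comp i hi hk hc x y, S.comp_mem i hi hk hc x.2 y.2⟩)
      (by intros; ext; simp)) (by intros; ext; simp)
  one_comp y := Subtype.ext (Q.one_comp y.1)
  comp_one i hi x := Subtype.ext (Q.comp_one i hi x.1)
  comp_assoc i j hi hj hij hk hr hl hr' he hg hf hg' x y z :=
    Subtype.ext (Q.comp_assoc i j hi hj hij hk hr hl hr' he hg hf hg' x.1 y.1 z.1)
  comp_parallel i j j' hlt hi hj hj' hjk hil hk hr hl hr' he hg hf hg' x y z :=
    Subtype.ext (Q.comp_parallel i j j' hlt hi hj hj' hjk hil hk hr hl hr' he hg hf hg' x.1 y.1 z.1)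

/-- The inclusion of a sub-operad. -/
def SubOperad.incl {Q : GrOperad.{u}} (S : SubOperad Q) : S.toOperad ⟶ Q :=
  GrOperad.Hom.mk (P := S.toOperad) (Q := Q) (fun {n a} => (S.carrier n a).subtype) rfl
    (fun _ _ _ _ _ _ => rfl)

/-- The sub-operad generated by a set of homogeneous operations: the intersection of all the
sub-operads containing it. -/
def SubOperad.closure {Q : GrOperad.{u}} (s : ∀ (n : ℕ) (a : ℤ), Set (Q.obj n a)) :
    SubOperad Q where
  carrier n a :=
    ⨅ S : {S : SubOperad Q // ∀ n a, s n a ⊆ S.carrier n a}, S.1.carrier n a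
  one_mem := by
    simp only [AddSubgroup.mem_iInf]
    exact fun S => S.1.one_mem
  comp_mem := by
    intro m n k a b c i hi hk hc x y hx hy
    simp only [AddSubgroup.mem_iInf] at hx hy ⊢
    exact fun S => S.1.comp_mem i hi hk hc (hx S) (hy S)

/-! ### Free operads -/

/-- Formal operadic expressions in a family `X` of generators with arities and degrees. -/
inductive Pre (X : ℕ → ℤ → Type u) : ℕ → ℤ → Type u
  | gen {n : ℕ} {a : ℤ} (x : X n a) : Pre X n a
  | one : Pre X 1 0
  | comp {m n k : ℕ} {a b c : ℤ} (i : ℕ) (hi : i < m) (hk : m + n = k + 1) (hc : a + b = c)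
      (x : Pre X m a) (y : Pre X n b) : Pre X k c
  | zero {n : ℕ} {a : ℤ} : Pre X n a
  | add {n : ℕ} {a : ℤ} (x y : Pre X n a) : Pre X n a
  | neg {n : ℕ} {a : ℤ} (x : Pre X n a) : Pre X n a

/-- Formal multiplication by `(-1)^e`. -/
def Pre.sgn {X : ℕ → ℤ → Type u} {n : ℕ} {a : ℤ} (e : ℤ) (x : Pre X n a) : Pre X n a :=
  if Even e then x else x.neg

/-- The congruence generated by the axioms of a graded operad. -/
inductive Rel {X : ℕ → ℤ → Type u} : ∀ {n : ℕ} {a : ℤ}, Pre X n a → Pre X n a → Prop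
  | refl {n a} (x : Pre X n a) : Rel x x
  | symm {n a} {x y : Pre X n a} : Rel x y → Rel y x
  | trans {n a} {x y z : Pre X n a} : Rel x y → Rel y z → Rel x z
  | comp_congr {m n k a b c} (i : ℕ) (hi : i < m) (hk : m + n = k + 1) (hc : a + b = c)
      {x x' : Pre X m a} {y y' : Pre X n b} : Rel x x' → Rel y y' →
      Rel (Pre.comp i hi hk hc x y) (Pre.comp i hi hk hc x' y')
  | add_congr {n a} {x x' y y' : Pre X n a} : Rel x x' → Rel y y' → Rel (x.add y) (x'.add y')
  | neg_congr {n a} {x x' : Pre X n a} : Rel x x' → Rel x.neg x'.neg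
  | add_assoc {n a} (x y z : Pre X n a) : Rel ((x.add y).add z) (x.add (y.add z))
  | add_comm {n a} (x y : Pre X n a) : Rel (x.add y) (y.add x)
  | zero_add {n a} (x : Pre X n a) : Rel (Pre.zero.add x) x
  | neg_add {n a} (x : Pre X n a) : Rel (x.neg.add x) Pre.zero
  | add_comp {m n k a b c} (i : ℕ) (hi : i < m) (hk : m + n = k + 1) (hc : a + b = c)
      (x x' : Pre X m a) (y : Pre X n b) :
      Rel (Pre.comp i hi hk hc (x.add x') y)
        ((Pre.comp i hi hk hc x y).add (Pre.comp i hi hk hc x' y))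
  | comp_add {m n k a b c} (i : ℕ) (hi : i < m) (hk : m + n = k + 1) (hc : a + b = c)
      (x : Pre X m a) (y y' : Pre X n b) :
      Rel (Pre.comp i hi hk hc x (y.add y'))
        ((Pre.comp i hi hk hc x y).add (Pre.comp i hi hk hc x y'))
  | one_comp {n b} (y : Pre X n b) :
      Rel (Pre.comp 0 Nat.one_pos (Nat.add_comm 1 n) (_root_.zero_add b) Pre.one y) y
  | comp_one {m a} (i : ℕ) (hi : i < m) (x : Pre X m a) :
      Rel (Pre.comp i hi rfl (add_zero a) x Pre.one) x
  | comp_assoc {m n p k l r : ℕ} {a b c e f g : ℤ} (i j : ℕ) (hi : i < m) (hj : j < n)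
      (hij : i + j < k) (hk : m + n = k + 1) (hr : k + p = r + 1)
      (hl : n + p = l + 1) (hr' : m + l = r + 1)
      (he : a + b = e) (hg : e + c = g) (hf : b + c = f) (hg' : a + f = g)
      (x : Pre X m a) (y : Pre X n b) (z : Pre X p c) :
      Rel (Pre.comp (i + j) hij hr hg (Pre.comp i hi hk he x y) z)
        (Pre.comp i hi hr' hg' x (Pre.comp j hj hl hf y z))
  | comp_parallel {m n p k l r : ℕ} {a b c e f g : ℤ} (i j j' : ℕ) (hlt : i < j)
      (hi : i < m) (hj : j < m) (hj' : j + n = j' + 1) (hjk : j' < k) (hil : i < l)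
      (hk : m + n = k + 1) (hr : k + p = r + 1) (hl : m + p = l + 1) (hr' : l + n = r + 1)
      (he : a + b = e) (hg : e + c = g) (hf : a + c = f) (hg' : f + b = g)
      (x : Pre X m a) (y : Pre X n b) (z : Pre X p c) :
      Rel (Pre.comp j' hjk hr hg (Pre.comp i hi hk he x y) z)
        (Pre.sgn (b * c) (Pre.comp i hil hr' hg' (Pre.comp j hj hl hf x z) y))

/-- The setoid of formal expressions up to the operad axioms. -/
def preSetoid (X : ℕ → ℤ → Type u) (n : ℕ) (a : ℤ) : Setoid (Pre X n a) :=
  ⟨Rel, ⟨Rel.refl, Rel.symm, Rel.trans⟩⟩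

/-- Operations of the free operad on `X`. -/
def FreeObj (X : ℕ → ℤ → Type u) (n : ℕ) (a : ℤ) : Type u := Quotient (preSetoid X n a)

/-- The class of a formal expression. -/
def FreeObj.mk {X : ℕ → ℤ → Type u} {n : ℕ} {a : ℤ} (x : Pre X n a) : FreeObj X n a :=
  Quotient.mk (preSetoid X n a) x

theorem FreeObj.sound {X : ℕ → ℤ → Type u} {n : ℕ} {a : ℤ} {x y : Pre X n a} (h : Rel x y) :
    FreeObj.mk x = FreeObj.mk y := Quotient.sound (s := preSetoid X n a) h

theorem FreeObj.ind {X : ℕ → ℤ → Type u} {n : ℕ} {a : ℤ} {p : FreeObj X n a → Prop}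
    (h : ∀ x, p (FreeObj.mk x)) (x : FreeObj X n a) : p x := Quotient.ind h x

instance (X : ℕ → ℤ → Type u) (n : ℕ) (a : ℤ) : Add (FreeObj X n a) :=
  ⟨Quotient.map₂ Pre.add (fun _ _ h _ _ h' => Rel.add_congr h h')⟩

instance (X : ℕ → ℤ → Type u) (n : ℕ) (a : ℤ) : Zero (FreeObj X n a) :=
  ⟨FreeObj.mk Pre.zero⟩

instance (X : ℕ → ℤ → Type u) (n : ℕ) (a : ℤ) : Neg (FreeObj X n a) :=
  ⟨Quotient.map Pre.neg (fun _ _ h => Rel.neg_congr h)⟩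

instance (X : ℕ → ℤ → Type u) (n : ℕ) (a : ℤ) : AddCommGroup (FreeObj X n a) where
  add_assoc x y z := by
    induction x using FreeObj.ind; induction y using FreeObj.ind; induction z using FreeObj.ind
    exact FreeObj.sound (Rel.add_assoc _ _ _)
  add_comm x y := by
    induction x using FreeObj.ind; induction y using FreeObj.ind
    exact FreeObj.sound (Rel.add_comm _ _)
  zero_add x := by
    induction x using FreeObj.ind
    exact FreeObj.sound (Rel.zero_add _)
  add_zero x := by
    induction x using FreeObj.ind
    exact FreeObj.sound ((Rel.add_comm _ _).trans (Rel.zero_add _))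
  neg_add_cancel x := by
    induction x using FreeObj.ind
    exact FreeObj.sound (Rel.neg_add _)
  nsmul := nsmulRec
  zsmul := zsmulRec

theorem FreeObj.mk_add {X : ℕ → ℤ → Type u} {n : ℕ} {a : ℤ} (x y : Pre X n a) :
    FreeObj.mk (x.add y) = FreeObj.mk x + FreeObj.mk y := rfl

theorem FreeObj.mk_neg {X : ℕ → ℤ → Type u} {n : ℕ} {a : ℤ} (x : Pre X n a) :
    FreeObj.mk x.neg = - FreeObj.mk x := rfl

theorem FreeObj.mk_zero {X : ℕ → ℤ → Type u} {n : ℕ} {a : ℤ} :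
    FreeObj.mk (Pre.zero : Pre X n a) = 0 := rfl

theorem ksign_of_even {e : ℤ} (h : Even e) : ksign e = 1 := by
  simp [ksign, Int.negOnePow_even e h]

theorem ksign_of_not_even {e : ℤ} (h : ¬ Even e) : ksign e = -1 := by
  simp [ksign, Int.negOnePow_odd e (Int.not_even_iff_odd.mp h)]

theorem FreeObj.mk_sgn {X : ℕ → ℤ → Type u} {n : ℕ} {a : ℤ} (e : ℤ) (x : Pre X n a) :
    FreeObj.mk (x.sgn e) = ksign e • FreeObj.mk x := by
  unfold Pre.sgn
  split_ifs with h
  · rw [ksign_of_even h, one_smul]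
  · rw [ksign_of_not_even h, FreeObj.mk_neg, neg_smul, one_smul]

/-- Partial composition in the free operad. -/
def FreeObj.comp {X : ℕ → ℤ → Type u} {m n k : ℕ} {a b c : ℤ} (i : ℕ) (hi : i < m)
    (hk : m + n = k + 1) (hc : a + b = c) :
    FreeObj X m a →+ FreeObj X n b →+ FreeObj X k c :=
  AddMonoidHom.mk' (fun x => AddMonoidHom.mk'
    (fun y => Quotient.map₂ (Pre.comp i hi hk hc)
      (fun _ _ h _ _ h' => Rel.comp_congr i hi hk hc h h') x y)
    (by
      intro y y'
      induction x using FreeObj.ind; induction y using FreeObj.ind; induction y' using FreeObj.ind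
      exact FreeObj.sound (Rel.comp_add _ _ _ _ _ _ _)))
    (by
      intro x x'
      ext y
      induction x using FreeObj.ind; induction y using FreeObj.ind; induction x' using FreeObj.ind
      exact FreeObj.sound (Rel.add_comp _ _ _ _ _ _ _))

theorem FreeObj.mk_comp {X : ℕ → ℤ → Type u} {m n k : ℕ} {a b c : ℤ} (i : ℕ) (hi : i < m)
    (hk : m + n = k + 1) (hc : a + b = c) (x : Pre X m a) (y : Pre X n b) :
    FreeObj.mk (Pre.comp i hi hk hc x y) =
      FreeObj.comp i hi hk hc (FreeObj.mk x) (FreeObj.mk y) := rfl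

theorem FreeObj.comp_assoc {X : ℕ → ℤ → Type u} {m n p k l r : ℕ} {a b c e f g : ℤ} (i j : ℕ)
    (hi : i < m) (hj : j < n)
    (hij : i + j < k) (hk : m + n = k + 1) (hr : k + p = r + 1)
    (hl : n + p = l + 1) (hr' : m + l = r + 1)
    (he : a + b = e) (hg : e + c = g) (hf : b + c = f) (hg' : a + f = g)
    (x : FreeObj X m a) (y : FreeObj X n b) (z : FreeObj X p c) :
    FreeObj.comp (i + j) hij hr hg (FreeObj.comp i hi hk he x y) z =
      FreeObj.comp i hi hr' hg' x (FreeObj.comp j hj hl hf y z) := by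
  induction x using FreeObj.ind; induction y using FreeObj.ind; induction z using FreeObj.ind
  exact FreeObj.sound (Rel.comp_assoc i j hi hj hij hk hr hl hr' he hg hf hg' _ _ _)

theorem FreeObj.comp_parallel {X : ℕ → ℤ → Type u} {m n p k l r : ℕ} {a b c e f g : ℤ}
    (i j j' : ℕ) (hlt : i < j)
    (hi : i < m) (hj : j < m) (hj' : j + n = j' + 1) (hjk : j' < k) (hil : i < l)
    (hk : m + n = k + 1) (hr : k + p = r + 1) (hl : m + p = l + 1) (hr' : l + n = r + 1)
    (he : a + b = e) (hg : e + c = g) (hf : a + c = f) (hg' : f + b = g)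
    (x : FreeObj X m a) (y : FreeObj X n b) (z : FreeObj X p c) :
    FreeObj.comp j' hjk hr hg (FreeObj.comp i hi hk he x y) z =
      ksign (b * c) • FreeObj.comp i hil hr' hg' (FreeObj.comp j hj hl hf x z) y := by
  induction x using FreeObj.ind; induction y using FreeObj.ind; induction z using FreeObj.ind
  refine (FreeObj.sound (Rel.comp_parallel i j j' hlt hi hj hj' hjk hil hk hr hl hr'
    he hg hf hg' _ _ _)).trans ?_
  rw [FreeObj.mk_sgn]
  rfl

/-- The free graded operad on a family `X` of generators with arities and degrees. -/
def FreeOperad (X : ℕ → ℤ → Type u) : GrOperad.{u} where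
  obj := FreeObj X
  one := FreeObj.mk Pre.one
  comp := FreeObj.comp
  one_comp y := by
    induction y using FreeObj.ind
    exact FreeObj.sound (Rel.one_comp _)
  comp_one i hi x := by
    induction x using FreeObj.ind
    exact FreeObj.sound (Rel.comp_one i hi _)
  comp_assoc := FreeObj.comp_assoc
  comp_parallel := FreeObj.comp_parallel

/-- A generator, as an operation of the free operad. -/
def FreeOperad.gen {X : ℕ → ℤ → Type u} {n : ℕ} {a : ℤ} (x : X n a) : (FreeOperad X).obj n a :=
  FreeObj.mk (Pre.gen x)

/-- Evaluation of formal expressions in an operad. -/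
def Pre.eval {X : ℕ → ℤ → Type u} (R : GrOperad.{u}) (φ : ∀ {n : ℕ} {a : ℤ}, X n a → R.obj n a) :
    ∀ {n : ℕ} {a : ℤ}, Pre X n a → R.obj n a
  | _, _, .gen x => φ x
  | _, _, .one => R.one
  | _, _, .comp i hi hk hc x y => R.comp i hi hk hc (x.eval R φ) (y.eval R φ)
  | _, _, .zero => 0
  | _, _, .add x y => x.eval R φ + y.eval R φ
  | _, _, .neg x => - x.eval R φ

theorem Pre.eval_sgn {X : ℕ → ℤ → Type u} (R : GrOperad.{u})
    (φ : ∀ {n : ℕ} {a : ℤ}, X n a → R.obj n a) {n : ℕ} {a : ℤ} (e : ℤ) (x : Pre X n a) :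
    (x.sgn e).eval R φ = ksign e • x.eval R φ := by
  unfold Pre.sgn
  split_ifs with h
  · rw [ksign_of_even h, one_smul]
  · rw [ksign_of_not_even h, Pre.eval, neg_smul, one_smul]

theorem Rel.eval_eq {X : ℕ → ℤ → Type u} (R : GrOperad.{u})
    (φ : ∀ {n : ℕ} {a : ℤ}, X n a → R.obj n a) {n : ℕ} {a : ℤ} {x y : Pre X n a} (h : Rel x y) :
    x.eval R φ = y.eval R φ := by
  induction h with
  | refl => rfl
  | symm _ ih => exact ih.symm
  | trans _ _ ih ih' => exact ih.trans ih'
  | comp_congr _ _ _ _ _ _ ih ih' => simp only [Pre.eval, ih, ih']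
  | add_congr _ _ ih ih' => simp only [Pre.eval, ih, ih']
  | neg_congr _ ih => simp only [Pre.eval, ih]
  | add_assoc => simp only [Pre.eval, _root_.add_assoc]
  | add_comm => simp only [Pre.eval]; exact _root_.add_comm _ _
  | zero_add => simp only [Pre.eval, _root_.zero_add]
  | neg_add => simp only [Pre.eval, neg_add_cancel]
  | add_comp => simp only [Pre.eval, map_add, AddMonoidHom.add_apply]
  | comp_add => simp only [Pre.eval, map_add]
  | one_comp => simp only [Pre.eval]; exact R.one_comp _
  | comp_one => simp only [Pre.eval]; exact R.comp_one _ _ _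
  | comp_assoc => simp only [Pre.eval]; apply R.comp_assoc
  | comp_parallel => rw [Pre.eval_sgn]; simp only [Pre.eval]; apply R.comp_parallel <;> assumption

/-- The morphism out of a free operad with prescribed values on the generators. -/
def FreeOperad.lift {X : ℕ → ℤ → Type u} (R : GrOperad.{u})
    (φ : ∀ {n : ℕ} {a : ℤ}, X n a → R.obj n a) : FreeOperad X ⟶ R :=
  GrOperad.Hom.mk (P := FreeOperad X) (Q := R)
    (fun {n a} => AddMonoidHom.mk' (fun x : FreeObj X n a =>
        Quotient.lift (s := preSetoid X n a) (fun x => x.eval R φ) (fun _ _ h => Rel.eval_eq R φ h) x)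
      (by
        intro x y
        induction x using FreeObj.ind; induction y using FreeObj.ind
        rfl))
    rfl
    (by
      intro m n k a b c i hi hk hc x y
      induction x using FreeObj.ind; induction y using FreeObj.ind
      rfl)

/-! ### Differentials -/

/-- Families of additive maps lowering the homological degree by one and preserving the arity. -/
abbrev GrOperad.LowerMap (Q : GrOperad.{u}) : Type u :=
  ∀ {n : ℕ} {a b : ℤ}, b + 1 = a → (Q.obj n a →+ Q.obj n b)

/-- A nonsymmetric dg operad, with homological conventions: a graded operad with a degree `-1`
derivation of square zero. -/
structure DGOperad extends GrOperad.{u} where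
  d : toGrOperad.LowerMap
  d_comp : ∀ {m n k : ℕ} {a b c a' b' c' : ℤ} (i : ℕ) (hi : i < m) (hk : m + n = k + 1)
    (hc : a + b = c) (ha' : a' + 1 = a) (hb' : b' + 1 = b) (hc' : c' + 1 = c)
    (h₁ : a' + b = c') (h₂ : a + b' = c') (x : obj m a) (y : obj n b),
    d hc' (comp i hi hk hc x y) =
      comp i hi hk h₁ (d ha' x) y + ksign a • comp i hi hk h₂ x (d hb' y)
  d_d : ∀ {n : ℕ} {a b c : ℤ} (hb : b + 1 = a) (hc : c + 1 = b) (x : obj n a), d hc (d hb x) = 0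

/-- Morphisms of dg operads. -/
@[ext]
structure DGOperad.Hom (P Q : DGOperad.{u}) extends
    toGrHom : GrOperad.Hom P.toGrOperad Q.toGrOperad where
  map_d : ∀ {n : ℕ} {a b : ℤ} (h : b + 1 = a) (x : P.obj n a), map (P.d h x) = Q.d h (map x)

section Derivation

variable {X : ℕ → ℤ → Type u}
  (δ : ∀ {n : ℕ} {a : ℤ}, X n a → ∀ b : ℤ, b + 1 = a → FreeObj X n b)

/-- The derivation of the free operad with value `δ` on the generators, on formal expressions. -/
def Pre.deriv : ∀ {n : ℕ} {a : ℤ}, Pre X n a → ∀ b : ℤ, b + 1 = a → FreeObj X n b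
  | _, _, .gen x, b, h => δ x b h
  | _, _, .one, _, _ => 0
  | _, _, .comp (a := a) (b := b) i hi hk hc x y, _, h =>
      FreeObj.comp i hi hk (by omega) (x.deriv (a - 1) (by omega)) (FreeObj.mk y) +
        ksign a • FreeObj.comp i hi hk (by omega) (FreeObj.mk x) (y.deriv (b - 1) (by omega))
  | _, _, .zero, _, _ => 0
  | _, _, .add x y, b, h => x.deriv b h + y.deriv b h
  | _, _, .neg x, b, h => - x.deriv b h

theorem Pre.deriv_sgn {n : ℕ} {a : ℤ} (e : ℤ) (x : Pre X n a) (b : ℤ) (h : b + 1 = a) :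
    (x.sgn e).deriv δ b h = ksign e • x.deriv δ b h := by
  unfold Pre.sgn
  split_ifs with h
  · rw [ksign_of_even h, one_smul]
  · rw [ksign_of_not_even h, Pre.deriv, neg_smul, one_smul]

theorem Rel.deriv_eq {n : ℕ} {a : ℤ} {x y : Pre X n a} (h : Rel x y) :
    ∀ (b : ℤ) (hb : b + 1 = a), x.deriv δ b hb = y.deriv δ b hb := by
  induction h with
  | refl => intros; rfl
  | symm _ ih => intros; exact (ih _ _).symm
  | trans _ _ ih ih' => intros; exact (ih _ _).trans (ih' _ _)
  | comp_congr _ _ _ _ h h' ih ih' =>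
    intros
    simp only [Pre.deriv, ih, ih', FreeObj.sound h, FreeObj.sound h']
  | add_congr _ _ ih ih' => intros; simp only [Pre.deriv, ih, ih']
  | neg_congr _ ih => intros; simp only [Pre.deriv, ih]
  | add_assoc => intros; simp only [Pre.deriv, _root_.add_assoc]
  | add_comm => intros; simp only [Pre.deriv]; exact _root_.add_comm _ _
  | zero_add => intros; simp only [Pre.deriv, _root_.zero_add]
  | neg_add => intros; simp only [Pre.deriv, neg_add_cancel]
  | add_comp =>
    intros
    simp only [Pre.deriv, FreeObj.mk_add, map_add, AddMonoidHom.add_apply, smul_add]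
    abel
  | comp_add =>
    intros
    simp only [Pre.deriv, FreeObj.mk_add, map_add, smul_add]
    abel
  | one_comp y =>
    intro b' hb
    obtain rfl : b' = _ - 1 := eq_sub_of_add_eq hb
    simp only [Pre.deriv, map_zero, AddMonoidHom.zero_apply, _root_.zero_add,
      ksign_of_even Even.zero, one_smul]
    exact (FreeOperad X).one_comp _
  | comp_one i hi x =>
    intro b' hb
    obtain rfl : b' = _ - 1 := eq_sub_of_add_eq hb
    simp only [Pre.deriv, map_zero, smul_zero, add_zero]
    exact (FreeOperad X).comp_one i hi _
  | @comp_assoc m n p k l r a b c e f g i j hi hj hij hk hr hl hr' he hg hf hg' x y z =>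
    intro b' hb
    simp only [Pre.deriv, FreeObj.mk_comp, map_add, AddMonoidHom.add_apply, smul_add, map_zsmul,
      AddMonoidHom.smul_apply, smul_smul]
    rw [FreeObj.comp_assoc (a := a - 1) (f := f) i j hi hj hij hk hr hl hr' (by omega) (by omega)
        hf (by omega),
      FreeObj.comp_assoc (a := a) (b := b - 1) (f := f - 1) i j hi hj hij hk hr hl hr' (by omega)
        (by omega) (by omega) (by omega),
      FreeObj.comp_assoc (c := c - 1) (f := f - 1) i j hi hj hij hk hr hl hr' he (by omega)
        (by omega) (by omega), _root_.add_assoc]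
    have h : ksign e = ksign a * ksign b := by rw [← he, ksign_add]
    rw [h]
  | @comp_parallel m n p k l r a b c e f g i j j' hlt hi hj hj' hjk hil hk hr hl hr'
      he hg hf hg' x y z =>
    intro b' hb
    rw [Pre.deriv_sgn]
    simp only [Pre.deriv, FreeObj.mk_comp, map_add, AddMonoidHom.add_apply, smul_add, map_zsmul,
      AddMonoidHom.smul_apply, smul_smul]
    rw [FreeObj.comp_parallel (a := a - 1) (f := f - 1) i j j' hlt hi hj hj' hjk hil hk hr hl hr'
        (by omega) (by omega) (by omega) (by omega),
      FreeObj.comp_parallel (b := b - 1) (f := f) i j j' hlt hi hj hj' hjk hil hk hr hl hr'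
        (by omega) (by omega) hf (by omega),
      FreeObj.comp_parallel (c := c - 1) (f := f - 1) i j j' hlt hi hj hj' hjk hil hk hr hl hr' he
        (by omega) (by omega) (by omega)]
    simp only [smul_smul]
    have h1 : ksign a * ksign ((b - 1) * c) = ksign (b * c) * ksign f := by
      rw [← ksign_add, ← ksign_add, ← hf]
      have : b * c + (a + c) = a + (b - 1) * c + (c + c) := by ring
      rw [this, ksign_add _ (c + c), ksign_add c c, ksign_mul_self, mul_one]
    have h2 : ksign e * ksign (b * (c - 1)) = ksign (b * c) * ksign a := by
      rw [← ksign_add, ← ksign_add, ← he]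
      have : a + b + b * (c - 1) = b * c + a := by ring
      rw [this]
    rw [h1, h2]
    abel

/-- The derivation of degree `-1` of a free operad with prescribed values on the generators. -/
def FreeObj.deriv {n : ℕ} {a b : ℤ} (h : b + 1 = a) : FreeObj X n a →+ FreeObj X n b :=
  AddMonoidHom.mk' (fun x => Quotient.lift (s := preSetoid X n a) (fun x => x.deriv δ b h)
      (fun _ _ hr => Rel.deriv_eq δ hr b h) x)
    (by
      intro x y
      induction x using FreeObj.ind; induction y using FreeObj.ind
      rfl)

theorem FreeObj.deriv_mk {n : ℕ} {a b : ℤ} (h : b + 1 = a) (x : Pre X n a) :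
    FreeObj.deriv δ h (FreeObj.mk x) = x.deriv δ b h := rfl

theorem FreeObj.deriv_comp {m n k : ℕ} {a b c a' b' c' : ℤ} (i : ℕ) (hi : i < m)
    (hk : m + n = k + 1) (hc : a + b = c) (ha' : a' + 1 = a) (hb' : b' + 1 = b) (hc' : c' + 1 = c)
    (h₁ : a' + b = c') (h₂ : a + b' = c') (x : FreeObj X m a) (y : FreeObj X n b) :
    FreeObj.deriv δ hc' (FreeObj.comp i hi hk hc x y) =
      FreeObj.comp i hi hk h₁ (FreeObj.deriv δ ha' x) y +
        ksign a • FreeObj.comp i hi hk h₂ x (FreeObj.deriv δ hb' y) := by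
  obtain rfl : a' = a - 1 := eq_sub_of_add_eq ha'
  obtain rfl : b' = b - 1 := eq_sub_of_add_eq hb'
  induction x using FreeObj.ind; induction y using FreeObj.ind
  rfl

theorem ksign_pred {a a' : ℤ} (h : a' + 1 = a) : ksign a' = - ksign a := by
  rw [← h, ksign_add]
  simp [ksign]

/-- A derivation of a free operad squares to zero as soon as it does so on generators. -/
theorem FreeObj.deriv_deriv
    (hδ : ∀ {n : ℕ} {a : ℤ} (x : X n a) (b c : ℤ) (hb : b + 1 = a) (hc : c + 1 = b),
      FreeObj.deriv δ hc (δ x b hb) = 0)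
    {n : ℕ} {a b c : ℤ} (hb : b + 1 = a) (hc : c + 1 = b) (x : FreeObj X n a) :
    FreeObj.deriv δ hc (FreeObj.deriv δ hb x) = 0 := by
  induction x using FreeObj.ind with
  | h x =>
    induction x generalizing b c with
    | gen x => exact hδ x b c hb hc
    | one => simp only [FreeObj.deriv_mk, Pre.deriv, map_zero]
    | @comp m n k a₁ a₂ a₃ i hi hk h x y ihx ihy =>
      rw [FreeObj.mk_comp,
        FreeObj.deriv_comp δ i hi hk h (a' := a₁ - 1) (b' := a₂ - 1) (by omega) (by omega) hb
          (by omega) (by omega),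
        map_add, map_zsmul,
        FreeObj.deriv_comp δ i hi hk (c := b) (a' := a₁ - 2) (b' := a₂ - 1) (by omega) (by omega)
          (by omega) hc (by omega) (by omega),
        FreeObj.deriv_comp δ i hi hk (c := b) (a' := a₁ - 1) (b' := a₂ - 2) (by omega) (by omega)
          (by omega) hc (by omega) (by omega), ihx, ihy,
        ksign_pred (a := a₁) (a' := a₁ - 1) (by omega)]
      simp
    | zero => simp only [FreeObj.mk_zero, map_zero]
    | add x y ihx ihy => simp only [FreeObj.mk_add, map_add, ihx, ihy, add_zero]
    | neg x ihx => simp only [FreeObj.mk_neg, map_neg, ihx, neg_zero]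

end Derivation

/-! ### The curved A-infinity operad -/

/-- Generators `μ_n`, `n ≥ 0`, of arity `n` and degree `-1`. -/
inductive CAGen : ℕ → ℤ → Type u
  | mu (n : ℕ) : CAGen n (-1)

/-- The operation `μ_n` of the free operad on the generators. -/
def mu (n : ℕ) : FreeObj CAGen.{u} n (-1) := FreeObj.mk (Pre.gen (CAGen.mu n))

/-- `- ∑_{p+q+r=n} μ_{p+1+r} ∘_{p+1} μ_q`. The sum runs over `0 ≤ q ≤ n` and
`0 ≤ p ≤ n - q`; then `r = n - q - p`, so that `p + 1 + r = n + 1 - q`. -/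
def muDiff (n : ℕ) (b : ℤ) (hb : b + 1 = -1) : FreeObj CAGen.{u} n b :=
  - ∑ q : Fin (n + 1), ∑ p : Fin (n + 1 - q),
      FreeObj.comp (p : ℕ) p.2 (by omega) (by omega) (mu (n + 1 - q)) (mu q)

/-- The values of the differential on the generators. -/
def caGenDiff : ∀ {n : ℕ} {a : ℤ}, CAGen.{u} n a → ∀ b : ℤ, b + 1 = a → FreeObj CAGen.{u} n b
  | _, _, .mu n, b, hb => muDiff n b hb

/-- Partial composition extended by zero to all indices; only used to manipulate sums. -/
def tcomp {X : ℕ → ℤ → Type u} {m n : ℕ} {a b : ℤ} (k : ℕ) (c : ℤ) (i : ℕ)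
    (x : FreeObj X m a) (y : FreeObj X n b) : FreeObj X k c :=
  if h : i < m ∧ m + n = k + 1 ∧ a + b = c then FreeObj.comp i h.1 h.2.1 h.2.2 x y else 0

theorem tcomp_eq {X : ℕ → ℤ → Type u} {m n k : ℕ} {a b c : ℤ} (i : ℕ) (hi : i < m)
    (hk : m + n = k + 1) (hc : a + b = c) (x : FreeObj X m a) (y : FreeObj X n b) :
    FreeObj.comp i hi hk hc x y = tcomp k c i x y := by
  rw [tcomp, dif_pos ⟨hi, hk, hc⟩]

theorem sum_tcomp {ι : Type*} {X : ℕ → ℤ → Type u} {m n : ℕ} {a b : ℤ} (k : ℕ) (c : ℤ) (i : ℕ)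
    (s : Finset ι) (x : ι → FreeObj X m a) (y : FreeObj X n b) :
    tcomp k c i (∑ j ∈ s, x j) y = ∑ j ∈ s, tcomp k c i (x j) y := by
  unfold tcomp
  split_ifs
  · rw [map_sum, AddMonoidHom.finsetSum_apply]
  · rw [Finset.sum_const_zero]

theorem tcomp_sum {ι : Type*} {X : ℕ → ℤ → Type u} {m n : ℕ} {a b : ℤ} (k : ℕ) (c : ℤ) (i : ℕ)
    (s : Finset ι) (x : FreeObj X m a) (y : ι → FreeObj X n b) :
    tcomp k c i x (∑ j ∈ s, y j) = ∑ j ∈ s, tcomp k c i x (y j) := by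
  unfold tcomp
  split_ifs
  · rw [map_sum]
  · rw [Finset.sum_const_zero]

theorem muDiff_eq (n : ℕ) (b : ℤ) (hb : b + 1 = -1) :
    muDiff.{u} n b hb = - ∑ q ∈ Finset.range (n + 1), ∑ p ∈ Finset.range (n + 1 - q),
      tcomp n b p (mu (n + 1 - q)) (mu q) := by
  unfold muDiff
  simp only [tcomp_eq]
  rw [Finset.sum_range]
  congr 1
  refine Finset.sum_congr rfl fun q _ => ?_
  rw [Finset.sum_range]

theorem deriv_mu (n : ℕ) (b : ℤ) (hb : b + 1 = -1) :
    FreeObj.deriv caGenDiff.{u} hb (mu n) = muDiff n b hb := rfl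

/-- The sum of all the composites `(μ_a ∘_i μ_b) ∘_j μ_c` of arity `n` equals the sum of all the
composites `μ_a ∘_i (μ_b ∘_j μ_c)`: the parallel ones cancel in pairs. -/
theorem mu_sum (n : ℕ) :
    ∑ q ∈ Finset.range (n + 1), ∑ p ∈ Finset.range (n + 1 - q),
      ∑ q' ∈ Finset.range (n + 1 - q + 1), ∑ p' ∈ Finset.range (n + 1 - q + 1 - q'),
        tcomp n (-3) p (tcomp (n + 1 - q) (-2) p' (mu.{u} (n + 1 - q + 1 - q')) (mu.{u} q'))
          (mu.{u} q) =
    ∑ q ∈ Finset.range (n + 1), ∑ p ∈ Finset.range (n + 1 - q),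
      ∑ q' ∈ Finset.range (q + 1), ∑ p' ∈ Finset.range (q + 1 - q'),
        tcomp n (-3) p (mu.{u} (n + 1 - q)) (tcomp q (-2) p' (mu.{u} (q + 1 - q')) (mu.{u} q')) := by
  have par : ∀ q p q' p' : ℕ, q < n + 1 → p < n + 1 - q → q' < n + 1 - q + 1 →
      p' < n + 1 - q + 1 - q' → p < p' →
      tcomp n (-3) p (tcomp (n + 1 - q) (-2) p' (mu.{u} (n + 1 - q + 1 - q')) (mu.{u} q'))
          (mu.{u} q) +
        tcomp n (-3) (p' + q - 1)
          (tcomp (n + 1 - q') (-2) p (mu.{u} (n + 1 - q' + 1 - q)) (mu.{u} q)) (mu.{u} q') = 0 := by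
    intro q p q' p' h1 h2 h3 h4 h5
    have hm : n + 1 - q' + 1 - q = n + 1 - q + 1 - q' := by omega
    rw [hm, ← tcomp_eq (c := -2) p' (by omega) (by omega) (by omega),
      ← tcomp_eq (c := -3) p (by omega) (by omega) (by omega),
      ← tcomp_eq (c := -2) p (by omega) (by omega) (by omega),
      ← tcomp_eq (c := -3) (p' + q - 1) (by omega) (by omega) (by omega),
      FreeObj.comp_parallel (l := n + 1 - q) (f := -2) p p' (p' + q - 1) h5 (by omega) (by omega)
        (by omega) (by omega) (by omega) (by omega) (by omega) (by omega) (by omega) (by omega)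
        (by omega) (by omega) (by omega)]
    have : ksign (-1 * -1) = -1 := by simp [ksign]
    rw [this, neg_smul, one_smul, add_neg_cancel]
  simp only [Finset.sum_sigma']
  rw [← Finset.sum_filter_add_sum_filter_not _
    (fun t : (_ : ℕ) × (_ : ℕ) × (_ : ℕ) × ℕ =>
      t.2.2.2 ≤ t.2.1 ∧ t.2.1 < t.2.2.2 + t.2.2.1)]
  conv_rhs => rw [← add_zero (Finset.sum _ _)]
  congr 1
  · refine Finset.sum_bij'
      (fun t _ => ⟨t.1 + t.2.2.1 - 1, t.2.2.2, t.1, t.2.1 - t.2.2.2⟩)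
      (fun t _ => ⟨t.2.2.1, t.2.1 + t.2.2.2, t.1 + 1 - t.2.2.1, t.2.1⟩) ?_ ?_ ?_ ?_ ?_
    · rintro ⟨q, p, q', p'⟩ h
      simp only [Finset.mem_filter, Finset.mem_sigma, Finset.mem_range] at h ⊢
      omega
    · rintro ⟨q, p, q', p'⟩ h
      simp only [Finset.mem_filter, Finset.mem_sigma, Finset.mem_range] at h ⊢
      omega
    · rintro ⟨q, p, q', p'⟩ h
      simp only [Finset.mem_filter, Finset.mem_sigma, Finset.mem_range] at h
      have e1 : p' + (p - p') = p := by omega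
      have e2 : q + q' - 1 + 1 - q = q' := by omega
      simp only [e1, e2]
    · rintro ⟨q, p, q', p'⟩ h
      simp only [Finset.mem_sigma, Finset.mem_range] at h
      have e1 : p + p' - p = p' := by omega
      have e2 : q' + (q + 1 - q') - 1 = q := by omega
      simp only [e1, e2]
    · rintro ⟨q, p, q', p'⟩ h
      simp only [Finset.mem_filter, Finset.mem_sigma, Finset.mem_range] at h
      have e1 : q + q' - 1 + 1 - q = q' := by omega
      have e2 : n + 1 - (q + q' - 1) = n + 1 - q + 1 - q' := by omega
      obtain ⟨j, rfl⟩ : ∃ j, p = p' + j := ⟨p - p', by omega⟩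
      have e3 : p' + j - p' = j := by omega
      dsimp only
      rw [e1, e2, e3, ← tcomp_eq (c := -2) p' (by omega) (by omega) (by omega),
        ← tcomp_eq (c := -3) (p' + j) (by omega) (by omega) (by omega),
        ← tcomp_eq (c := -2) j (by omega) (by omega) (by omega),
        ← tcomp_eq (c := -3) p' (by omega) (by omega) (by omega)]
      apply FreeObj.comp_assoc
  · refine Finset.sum_involution
      (fun t _ => if t.2.1 < t.2.2.2 then ⟨t.2.2.1, t.2.2.2 + t.1 - 1, t.1, t.2.1⟩
        else ⟨t.2.2.1, t.2.2.2, t.1, t.2.1 + 1 - t.2.2.1⟩) ?_ ?_ ?_ ?_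
    · rintro ⟨q, p, q', p'⟩ h
      simp only [Finset.mem_filter, Finset.mem_sigma, Finset.mem_range] at h
      dsimp only
      by_cases hlt : p < p'
      · rw [if_pos hlt]
        exact par q p q' p' (by omega) (by omega) (by omega) (by omega) hlt
      · rw [if_neg hlt]
        have := par q' p' q (p + 1 - q') (by omega) (by omega) (by omega) (by omega) (by omega)
        have e : p + 1 - q' + q' - 1 = p := by omega
        rw [e] at this
        rw [add_comm]
        exact this
    · rintro ⟨q, p, q', p'⟩ h _ heq
      simp only [Finset.mem_filter, Finset.mem_sigma, Finset.mem_range] at h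
      dsimp only at heq
      by_cases hlt : p < p'
      · rw [if_pos hlt] at heq
        simp only [Sigma.mk.injEq, heq_eq_eq] at heq
        omega
      · rw [if_neg hlt] at heq
        simp only [Sigma.mk.injEq, heq_eq_eq] at heq
        omega
    · rintro ⟨q, p, q', p'⟩ h
      simp only [Finset.mem_filter, Finset.mem_sigma, Finset.mem_range] at h
      dsimp only
      by_cases hlt : p < p'
      · rw [if_pos hlt]
        simp only [Finset.mem_filter, Finset.mem_sigma, Finset.mem_range]
        omega
      · rw [if_neg hlt]
        simp only [Finset.mem_filter, Finset.mem_sigma, Finset.mem_range]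
        omega
    · rintro ⟨q, p, q', p'⟩ h
      simp only [Finset.mem_filter, Finset.mem_sigma, Finset.mem_range] at h
      dsimp only
      by_cases hlt : p < p'
      · have e : p' + q - 1 + 1 - q = p' := by omega
        rw [if_pos hlt]
        dsimp only
        rw [if_neg (by omega), e]
      · have e : p + 1 - q' + q' - 1 = p := by omega
        rw [if_neg hlt]
        dsimp only
        rw [if_pos (by omega), e]

theorem caGenDiff_sq {n : ℕ} {a : ℤ} (x : CAGen.{u} n a) (b c : ℤ) (hb : b + 1 = a)
    (hc : c + 1 = b) : FreeObj.deriv caGenDiff.{u} hc (caGenDiff x b hb) = 0 := by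
  cases x with
  | mu =>
    obtain rfl : b = -2 := by omega
    obtain rfl : c = -3 := by omega
    change FreeObj.deriv caGenDiff.{u} hc (muDiff n (-2) hb) = 0
    have step : FreeObj.deriv caGenDiff.{u} hc (muDiff.{u} n (-2) hb) =
        - ∑ q : Fin (n + 1), ∑ p : Fin (n + 1 - q),
          (tcomp n (-3) p (muDiff (n + 1 - q) (-2) hb) (mu q) -
            tcomp n (-3) p (mu (n + 1 - q)) (muDiff q (-2) hb)) := by
      rw [muDiff, map_neg, map_sum]
      congr 1
      refine Finset.sum_congr rfl fun q _ => ?_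
      rw [map_sum]
      refine Finset.sum_congr rfl fun p _ => ?_
      rw [FreeObj.deriv_comp caGenDiff (p : ℕ) p.2 (a' := -2) (b' := -2) _ _ hb hb hc (by omega)
        (by omega), deriv_mu, deriv_mu, tcomp_eq, tcomp_eq, ksign_neg_one, neg_smul, one_smul,
        sub_eq_add_neg]
    have tneg : ∀ {m n k : ℕ} {a b c : ℤ} (i : ℕ) (x : FreeObj CAGen.{u} m a)
        (y : FreeObj CAGen.{u} n b), tcomp k c i (-x) y = - tcomp k c i x y := by
      intros; unfold tcomp; split_ifs <;> simp
    have tneg' : ∀ {m n k : ℕ} {a b c : ℤ} (i : ℕ) (x : FreeObj CAGen.{u} m a)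
        (y : FreeObj CAGen.{u} n b), tcomp k c i x (-y) = - tcomp k c i x y := by
      intros; unfold tcomp; split_ifs <;> simp
    rw [step]
    simp only [muDiff_eq, tneg, tneg', sum_tcomp, tcomp_sum, Finset.sum_sub_distrib,
      Finset.sum_neg_distrib]
    have key := mu_sum.{u} n
    simp only [Finset.sum_range (n := n + 1), Finset.sum_range (n := n + 1 - _)] at key
    simp only [Finset.sum_range] at key ⊢
    rw [key]
    simp

/-- The curved A-infinity operad: the free operad on `μ_n`, `n ≥ 0`, of arity `n` and degree `-1`,
with `d μ_n = - ∑_{p+q+r=n} μ_{p+1+r} ∘_{p+1} μ_q`. -/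
def cAInf : DGOperad.{u} where
  toGrOperad := FreeOperad CAGen.{u}
  d := FreeObj.deriv caGenDiff.{u}
  d_comp := FreeObj.deriv_comp caGenDiff.{u}
  d_d := FreeObj.deriv_deriv caGenDiff.{u} caGenDiff_sq

/-- The sub-operad `⟨μ_i⟩_{i > 0}` of the underlying graded operad of `cAInf`. -/
def cAInfPos : SubOperad cAInf.{u}.toGrOperad :=
  SubOperad.closure fun n a => {x | 0 < n ∧ ∃ g : CAGen.{u} n a, x = FreeOperad.gen g}

/-! ### The category of curved operads -/

/-- The generator `κ`, of arity `0` and degree `-1`. -/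
inductive KGen : ℕ → ℤ → Type u
  | kappa : KGen 0 (-1)

/-- The operad `[κ]` generated by a single operation of arity `0` and degree `-1`. -/
abbrev kappaOperad : GrOperad.{u} := FreeOperad KGen.{u}

/-- The morphism `[κ] ⟶ Q` classified by an operation of arity `0` and degree `-1`. -/
def kappaHom (Q : GrOperad.{u}) (κ : Q.obj 0 (-1)) : kappaOperad.{u} ⟶ Q :=
  FreeOperad.lift Q (fun {_ _} g => match g with | .kappa => κ)

/-- Operadic expressions in elements of `Q₀` and `κ` in which `κ` appears exactly `w` times. -/
inductive IsMonomial {Q : GrOperad.{u}} (κ : Q.obj 0 (-1)) (Q₀ : SubOperad Q) :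
    ℕ → ∀ {n : ℕ} {a : ℤ}, Q.obj n a → Prop
  | base {n : ℕ} {a : ℤ} {x : Q.obj n a} : x ∈ Q₀.carrier n a → IsMonomial κ Q₀ 0 x
  | kappa : IsMonomial κ Q₀ 1 κ
  | comp {v w m n k : ℕ} {a b c : ℤ} (i : ℕ) (hi : i < m) (hk : m + n = k + 1) (hc : a + b = c)
      {x : Q.obj m a} {y : Q.obj n b} : IsMonomial κ Q₀ v x → IsMonomial κ Q₀ w y →
      IsMonomial κ Q₀ (v + w) (Q.comp i hi hk hc x y)

/-- The weight `w` part of `Q`: the span of the expressions in which `κ` appears `w` times. -/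
def weightPart {Q : GrOperad.{u}} (κ : Q.obj 0 (-1)) (Q₀ : SubOperad Q) (w n : ℕ) (a : ℤ) :
    AddSubgroup (Q.obj n a) :=
  AddSubgroup.closure {x | IsMonomial κ Q₀ w x}

/-- The conditions on a quadruple `(Q, d, κ, Q₀)` for being an object of `Curv`. -/
structure IsCurved (Q : DGOperad.{u}) (κ : Q.obj 0 (-1)) (Q₀ : SubOperad Q.toGrOperad) :
    Prop where
  kappa_notMem : κ ∉ Q₀.carrier 0 (-1)
  /-- `Q` is the coproduct `Q₀ ∨ [κ]` in graded operads. -/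
  isCoproduct : Nonempty (Limits.IsColimit
    (Limits.BinaryCofan.mk Q₀.incl (kappaHom Q.toGrOperad κ)))
  /-- `d = d₀ + d₁`, where `dᵢ` raises the weight by `i`, and `d₁ κ = 0`. (As `Q` is the direct sum
  of its weight parts by the previous condition, `d₀` and `d₁` are determined by `d`.) -/
  strictMixed : ∃ d₀ d₁ : Q.toGrOperad.LowerMap,
    (∀ {n : ℕ} {a b : ℤ} (h : b + 1 = a) (x : Q.obj n a), Q.d h x = d₀ h x + d₁ h x) ∧
    (∀ {n : ℕ} {a b : ℤ} (h : b + 1 = a) (w : ℕ) (x : Q.obj n a),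
      x ∈ weightPart κ Q₀ w n a → d₀ h x ∈ weightPart κ Q₀ w n b) ∧
    (∀ {n : ℕ} {a b : ℤ} (h : b + 1 = a) (w : ℕ) (x : Q.obj n a),
      x ∈ weightPart κ Q₀ w n a → d₁ h x ∈ weightPart κ Q₀ (w + 1) n b) ∧
    (∀ {b : ℤ} (h : b + 1 = -1), d₁ h κ = 0)

/-- Objects of `Curv`. -/
structure Curv where
  Q : DGOperad.{u}
  κ : Q.obj 0 (-1)
  Q₀ : SubOperad Q.toGrOperad
  isCurved : IsCurved Q κ Q₀

/-- Morphisms of `Curv`: morphisms of dg operads that send `κ` to `κ` and `Q₀` into `Q₀`. -/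
@[ext]
structure Curv.Hom (P Q : Curv.{u}) extends toDGHom : DGOperad.Hom P.Q Q.Q where
  map_kappa : map P.κ = Q.κ
  map_mem : ∀ {n : ℕ} {a : ℤ} (x : P.Q.obj n a),
    x ∈ P.Q₀.carrier n a → map x ∈ Q.Q₀.carrier n a

instance : Category Curv.{u} where
  Hom := Curv.Hom
  id P :=
    { map := AddMonoidHom.id _
      map_one := rfl
      map_comp := fun _ _ _ _ _ _ => rfl
      map_d := fun _ _ => rfl
      map_kappa := rfl
      map_mem := fun _ h => h }
  comp f g :=
    { map := g.map.comp f.map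
      map_one := by simp [f.map_one, g.map_one]
      map_comp := by intros; simp [f.map_comp, g.map_comp]
      map_d := by intros; simp [f.map_d, g.map_d]
      map_kappa := by simp [f.map_kappa, g.map_kappa]
      map_mem := fun x h => g.map_mem _ (f.map_mem x h) }

end CurvedOperad

namespace CurvedOperad

/-! ### Marking one input -/

section Marked

variable (Q : GrOperad.{u})

/-! Since `cAInf` is free as a graded operad, a morphism to `(Q, d, κ, Q₀)` is a family of
operations `m n` with `m 0 = κ`, `m n ∈ Q₀` for `n > 0`, and, for every `n`, `d (m n) = - (∑_p m
(n+1) ∘_p κ + posSum m n)`. Here `posSum m n` collects the terms with `q > 0`, which involve only `m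
1, …, m n`. The equation at `n` is therefore an equation for `m (n+1)`, and initiality means that
this recursion has exactly one solution.

Uniqueness: on `Q₀` the map `x ↦ ∑_p x ∘_p κ` is injective (`eq_zero_of_sum_comp_kappa`).

Existence: by the weight conditions `d (m n) = x + ∑_i y_i ∘_i κ` with `x` and the `y_i` in `Q₀`.
The equation is solvable once `x = - posSum m n` and all the `y_i` coincide. Comparing `d² = 0` in
`Q` with `d² = 0` in `cAInf`, both at index `n - 1`, shows that the defect `E` of the equation,
formed with any element of `Q₀` in place of the unknown, satisfies `∑_p E ∘_p κ = 0`
(`sum_comp_defect`). In `Q₀ ∨ [κ]` the weight one part of this relation gives the condition on `x`;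
the weight two part, where two copies of `κ` anticommute, gives the symmetry of the `y_i`
(`eq_of_sum_comp_kappa_add_comp_kappa`). The recursion starts because `d₁ κ = 0` leaves `d κ = y ∘
κ`.

Both independence statements need coefficients to be read off in a coproduct known only by its
universal property. For this, `Q` is extended by a square-zero ideal of operations with one marked
input, `markedExtension`. The universal property yields a derivation `D` that vanishes on `Q₀` and
replaces each `κ` in turn by a mark. Thus `D (x ∘_i κ)` is `x` marked at `i`, and a second
application handles weight two.

That `cAInf` is itself curved is a matter of generators: `μ_0` and the other `μ_n` split the free
operad, and the differential of each generator splits by weight. -/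

theorem GrOperad.comp_assoc' {m n p k l r : ℕ} {a b c e f g : ℤ} (i j i' : ℕ) (hi : i < m)
    (hj : j < n) (hi' : i' = i + j)
    (hij : i' < k) (hk : m + n = k + 1) (hr : k + p = r + 1)
    (hl : n + p = l + 1) (hr' : m + l = r + 1)
    (he : a + b = e) (hg : e + c = g) (hf : b + c = f) (hg' : a + f = g)
    (x : Q.obj m a) (y : Q.obj n b) (z : Q.obj p c) :
    Q.comp i' hij hr hg (Q.comp i hi hk he x y) z =
      Q.comp i hi hr' hg' x (Q.comp j hj hl hf y z) := by
  subst hi'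
  exact Q.comp_assoc i j hi hj hij hk hr hl hr' he hg hf hg' x y z

theorem GrOperad.smul_comp_parallel {m n p k l r : ℕ} {a b c e f g : ℤ} {u v : ℤ}
    (i j j' : ℕ) (huv : u * ksign (b * c) = v) (hlt : i < j)
    (hi : i < m) (hj : j < m) (hj' : j + n = j' + 1) (hjk : j' < k) (hil : i < l)
    (hk : m + n = k + 1) (hr : k + p = r + 1) (hl : m + p = l + 1) (hr' : l + n = r + 1)
    (he : a + b = e) (hg : e + c = g) (hf : a + c = f) (hg' : f + b = g)
    (x : Q.obj m a) (y : Q.obj n b) (z : Q.obj p c) :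
    u • Q.comp j' hjk hr hg (Q.comp i hi hk he x y) z =
      v • Q.comp i hil hr' hg' (Q.comp j hj hl hf x z) y := by
  rw [Q.comp_parallel i j j' hlt hi hj hj' hjk hil hk hr hl hr' he hg hf hg', smul_smul, huv]

variable {Q}

/-- Composition of a family of operations with one marked input with an unmarked operation. The
value of a family at `t` is an operation whose input `t` is marked; marking commutes with
operations up to the Koszul sign of a symbol of degree `-1`. -/
def markedLeft {m n k : ℕ} {a b c : ℤ} (i : ℕ) (hi : i < m) (hk : m + n = k + 1) (hc : a + b = c)
    (X : ℕ → Q.obj (m + 1) (a + 1)) (y : Q.obj n b) (t : ℕ) : Q.obj (k + 1) (c + 1) :=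
  -- The mark lies to the left or to the right of the inputs of `y`. The index `t` counts inputs of
  -- the composite, hence the shifts to `i + 1` and to `t + 1 - n`. For `n = 0` and `t = i` both
  -- summands are present: the vanished input leaves its two neighbouring gaps in the same place.
  (if t ≤ i then ksign b • Q.comp (i + 1) (by omega) (by omega) (by omega) (X t) y else 0) +
    (if i + n ≤ t then
      ksign b • Q.comp i (by omega) (by omega) (by omega) (X (t + 1 - n)) y else 0)

/-- Composition of an unmarked operation with a family of operations with one marked input. -/
def markedRight {m n k : ℕ} {a b c : ℤ} (i : ℕ) (hi : i < m) (hk : m + n = k + 1) (hc : a + b = c)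
    (x : Q.obj m a) (Y : ℕ → Q.obj (n + 1) (b + 1)) (t : ℕ) : Q.obj (k + 1) (c + 1) :=
  if i ≤ t ∧ t ≤ i + n then Q.comp i hi (by omega) (by omega) x (Y (t - i)) else 0

/-! ### Operad axioms for marked operations -/

section Axioms

variable {i m n p k l r : ℕ} {a b c e f g : ℤ}

theorem markedLeft_add {hi : i < m} {hk : m + n = k + 1} {hc : a + b = c}
    (X X' : ℕ → Q.obj (m + 1) (a + 1)) (y : Q.obj n b) :
    markedLeft i hi hk hc (X + X') y = markedLeft i hi hk hc X y + markedLeft i hi hk hc X' y := by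
  funext t
  simp only [markedLeft, Pi.add_apply, map_add, AddMonoidHom.add_apply, smul_add]
  split_ifs <;> abel

theorem markedLeft_add_right {hi : i < m} {hk : m + n = k + 1} {hc : a + b = c}
    (X : ℕ → Q.obj (m + 1) (a + 1)) (y y' : Q.obj n b) :
    markedLeft i hi hk hc X (y + y') = markedLeft i hi hk hc X y + markedLeft i hi hk hc X y' := by
  funext t
  simp only [markedLeft, Pi.add_apply, map_add, smul_add]
  split_ifs <;> abel

theorem markedRight_add {hi : i < m} {hk : m + n = k + 1} {hc : a + b = c}
    (x x' : Q.obj m a) (Y : ℕ → Q.obj (n + 1) (b + 1)) :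
    markedRight i hi hk hc (x + x') Y =
      markedRight i hi hk hc x Y + markedRight i hi hk hc x' Y := by
  funext t
  simp only [markedRight, Pi.add_apply, map_add, AddMonoidHom.add_apply]
  split_ifs <;> abel

theorem markedRight_add_right {hi : i < m} {hk : m + n = k + 1} {hc : a + b = c}
    (x : Q.obj m a) (Y Y' : ℕ → Q.obj (n + 1) (b + 1)) :
    markedRight i hi hk hc x (Y + Y') =
      markedRight i hi hk hc x Y + markedRight i hi hk hc x Y' := by
  funext t
  simp only [markedRight, Pi.add_apply, map_add]
  split_ifs <;> abel

theorem markedLeft_assoc (i j : ℕ) (hi : i < m) (hj : j < n)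
    (hij : i + j < k) (hk : m + n = k + 1) (hr : k + p = r + 1)
    (hl : n + p = l + 1) (hr' : m + l = r + 1)
    (he : a + b = e) (hg : e + c = g) (hf : b + c = f) (hg' : a + f = g)
    (X : ℕ → Q.obj (m + 1) (a + 1)) (y : Q.obj n b) (z : Q.obj p c) :
    markedLeft (i + j) hij hr hg (markedLeft i hi hk he X y) z =
      markedLeft i hi hr' hg' X (Q.comp j hj hl hf y z) := by
  funext t
  have hs : ksign c * ksign b = ksign f := by rw [← hf, ksign_add, mul_comm]
  simp only [markedLeft]
  by_cases h1 : t ≤ i <;> by_cases h2 : i + l ≤ t <;> by_cases h3 : t ≤ i + j <;>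
    by_cases h4 : i + j + p ≤ t <;> first | (exfalso; omega) | skip
  all_goals
    simp (disch := omega) only [if_pos, if_neg, zero_add, add_zero, map_zsmul,
      AddMonoidHom.smul_apply, smul_smul, hs, map_zero, AddMonoidHom.zero_apply, smul_zero]
    try
      have ht : t + 1 - p + 1 - n = t + 1 - l := by omega
      rw [ht]
    try repeat' apply congrArg₂ (· + ·)
    all_goals try refine congrArg₂ (· • ·) rfl ?_
    all_goals try first
      | (apply Q.comp_assoc' (i + 1) j (i + j + 1) <;> omega)
      | exact Q.comp_assoc _ _ _ _ _ _ _ _ _ _ _ _ _ _ _ _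

theorem markedLeft_markedRight_assoc (i j : ℕ) (hi : i < m) (hj : j < n)
    (hij : i + j < k) (hk : m + n = k + 1) (hr : k + p = r + 1)
    (hl : n + p = l + 1) (hr' : m + l = r + 1)
    (he : a + b = e) (hg : e + c = g) (hf : b + c = f) (hg' : a + f = g)
    (x : Q.obj m a) (Y : ℕ → Q.obj (n + 1) (b + 1)) (z : Q.obj p c) :
    markedLeft (i + j) hij hr hg (markedRight i hi hk he x Y) z =
      markedRight i hi hr' hg' x (markedLeft j hj hl hf Y z) := by
  funext t
  simp only [markedLeft, markedRight]
  by_cases h0 : i ≤ t ∧ t ≤ i + l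
  · rw [if_pos h0, map_add]
    congr 1
    · by_cases h1 : t ≤ i + j
      · simp (disch := omega) only [if_pos, map_zsmul]
        congr 1
        apply Q.comp_assoc' i (j + 1) (i + j + 1) <;> omega
      · simp (disch := omega) only [if_neg, map_zero]
    · by_cases h1 : i + j + p ≤ t
      · have ht : t + 1 - p - i = t - i + 1 - p := by omega
        simp (disch := omega) only [if_pos, map_zsmul, ht]
        congr 1
        apply Q.comp_assoc
      · simp (disch := omega) only [if_neg, map_zero]
  · rw [if_neg h0]
    by_cases h1 : t ≤ i + j <;> by_cases h2 : i + j + p ≤ t <;> first | (exfalso; omega) |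
    simp (disch := omega) only [if_pos, if_neg, map_zero, AddMonoidHom.zero_apply, smul_zero,
      add_zero]

theorem markedRight_assoc (i j : ℕ) (hi : i < m) (hj : j < n)
    (hij : i + j < k) (hk : m + n = k + 1) (hr : k + p = r + 1)
    (hl : n + p = l + 1) (hr' : m + l = r + 1)
    (he : a + b = e) (hg : e + c = g) (hf : b + c = f) (hg' : a + f = g)
    (x : Q.obj m a) (y : Q.obj n b) (Z : ℕ → Q.obj (p + 1) (c + 1)) :
    markedRight (i + j) hij hr hg (Q.comp i hi hk he x y) Z =
      markedRight i hi hr' hg' x (markedRight j hj hl hf y Z) := by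
  funext t
  simp only [markedRight]
  by_cases h0 : i + j ≤ t ∧ t ≤ i + j + p
  · have ht : t - (i + j) = t - i - j := by omega
    simp (disch := omega) only [if_pos, ht]
    apply Q.comp_assoc
  · rw [if_neg h0]
    by_cases h1 : i ≤ t
    · rw [if_neg (show ¬ (j ≤ t - i ∧ t - i ≤ j + p) by omega), map_zero, ite_self]
    · rw [if_neg (show ¬ (i ≤ t ∧ t ≤ i + l) by omega)]

theorem markedLeft_parallel (i j j' : ℕ) (hlt : i < j)
    (hi : i < m) (hj : j < m) (hj' : j + n = j' + 1) (hjk : j' < k) (hil : i < l)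
    (hk : m + n = k + 1) (hr : k + p = r + 1) (hl : m + p = l + 1) (hr' : l + n = r + 1)
    (he : a + b = e) (hg : e + c = g) (hf : a + c = f) (hg' : f + b = g)
    (X : ℕ → Q.obj (m + 1) (a + 1)) (y : Q.obj n b) (z : Q.obj p c) :
    markedLeft j' hjk hr hg (markedLeft i hi hk he X y) z =
      ksign (b * c) • markedLeft i hil hr' hg' (markedLeft j hj hl hf X z) y := by
  funext t
  have hs : ksign c * ksign b * ksign (b * c) = ksign (b * c) * (ksign b * ksign c) := by ring
  simp only [markedLeft, Pi.smul_apply]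
  by_cases h1 : t ≤ i <;> by_cases h2 : i + n ≤ t <;> by_cases h3 : t ≤ j' <;>
    by_cases h4 : j' + p ≤ t <;> first | (exfalso; omega) | skip
  all_goals
    try have ht : t + 1 - p + 1 - n = t + 1 - n + 1 - p := by omega
    try simp only [ht]
    simp (disch := omega) only [if_pos, if_neg, zero_add, add_zero, map_zsmul,
      AddMonoidHom.smul_apply, smul_smul, smul_add, map_add, AddMonoidHom.add_apply, map_zero,
      AddMonoidHom.zero_apply, smul_zero, add_assoc]
    repeat' apply congrArg₂ (· + ·)
    all_goals first
      | (apply Q.smul_comp_parallel (i + 1) (j + 1) (j' + 1) hs <;> omega)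
      | (apply Q.smul_comp_parallel i (j + 1) (j' + 1) hs <;> omega)
      | (apply Q.smul_comp_parallel i j j' hs <;> omega)

/-- A marked operation of nominal degree `b` really has degree `b + 1`, so exchanging it with `z`
costs `(-1)^((b+1)c)`. The mark passing `z` contributes `(-1)^c`, and the product is the required
`(-1)^(bc)`. -/
theorem markedLeft_markedRight_parallel (i j j' : ℕ) (hlt : i < j)
    (hi : i < m) (hj : j < m) (hj' : j + n = j' + 1) (hjk : j' < k) (hil : i < l)
    (hk : m + n = k + 1) (hr : k + p = r + 1) (hl : m + p = l + 1) (hr' : l + n = r + 1)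
    (he : a + b = e) (hg : e + c = g) (hf : a + c = f) (hg' : f + b = g)
    (x : Q.obj m a) (Y : ℕ → Q.obj (n + 1) (b + 1)) (z : Q.obj p c) :
    markedLeft j' hjk hr hg (markedRight i hi hk he x Y) z =
      ksign (b * c) • markedRight i hil hr' hg' (Q.comp j hj hl hf x z) Y := by
  have hs : ksign c * ksign ((b + 1) * c) = ksign (b * c) := by
    rw [← ksign_add, show c + (b + 1) * c = b * c + (c + c) by ring, ksign_add, ksign_add c c,
      ksign_mul_self, mul_one]
  funext t
  simp only [markedLeft, markedRight, Pi.smul_apply]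
  by_cases h1 : i ≤ t <;> by_cases h2 : t ≤ i + n <;> by_cases h3 : t ≤ j' <;>
    by_cases h4 : j' + p ≤ t <;> first | (exfalso; omega) | skip
  all_goals
    simp (disch := omega) only [if_pos, if_neg, add_zero, map_zero,
      AddMonoidHom.zero_apply, smul_zero]
    try (apply Q.smul_comp_parallel i j (j' + 1) hs <;> omega)

/-- The marked third factor has degree `c + 1`; the surplus sign `(-1)^b` in the exchange is the
sign of the mark passing `y` in `markedLeft`. -/
theorem markedRight_parallel (i j j' : ℕ) (hlt : i < j)
    (hi : i < m) (hj : j < m) (hj' : j + n = j' + 1) (hjk : j' < k) (hil : i < l)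
    (hk : m + n = k + 1) (hr : k + p = r + 1) (hl : m + p = l + 1) (hr' : l + n = r + 1)
    (he : a + b = e) (hg : e + c = g) (hf : a + c = f) (hg' : f + b = g)
    (x : Q.obj m a) (y : Q.obj n b) (Z : ℕ → Q.obj (p + 1) (c + 1)) :
    markedRight j' hjk hr hg (Q.comp i hi hk he x y) Z =
      ksign (b * c) • markedLeft i hil hr' hg' (markedRight j hj hl hf x Z) y := by
  have hs : 1 * ksign (b * (c + 1)) = ksign (b * c) * ksign b := by
    rw [one_mul, mul_add, mul_one, ksign_add]
  funext t
  simp only [markedLeft, markedRight, Pi.smul_apply]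
  by_cases h1 : i + n ≤ t <;> by_cases h2 : t ≤ i <;> by_cases h3 : j' ≤ t <;>
    by_cases h4 : t ≤ j' + p <;> first | (exfalso; omega) | skip
  all_goals
    simp (disch := omega) only [if_pos, if_neg, zero_add, add_zero, map_zero,
      AddMonoidHom.zero_apply, smul_zero, smul_smul]
    try
      have ht : t - j' = t + 1 - n - j := by omega
      rw [ht]
      refine (one_smul ℤ _).symm.trans ?_
      apply Q.smul_comp_parallel i j j' hs <;> omega

end Axioms

/-- Families of operations with one marked input, supported on the actual inputs. -/
def markedFamily (Q : GrOperad.{u}) (n : ℕ) (a : ℤ) : AddSubgroup (ℕ → Q.obj (n + 1) (a + 1)) where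
  carrier := {X | ∀ t, n < t → X t = 0}
  zero_mem' := fun _ _ => rfl
  add_mem' := fun hX hY t ht => by simp [hX t ht, hY t ht]
  neg_mem' := fun hX t ht => by simp [hX t ht]

theorem markedLeft_mem {m n k : ℕ} {a b c : ℤ} (i : ℕ) (hi : i < m) (hk : m + n = k + 1)
    (hc : a + b = c) {X : ℕ → Q.obj (m + 1) (a + 1)} (hX : X ∈ markedFamily Q m a) (y : Q.obj n b) :
    markedLeft i hi hk hc X y ∈ markedFamily Q k c := by
  intro t ht
  simp only [markedLeft, hX (t + 1 - n) (by omega), map_zero, AddMonoidHom.zero_apply, smul_zero,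
    ite_self, add_zero]
  split_ifs with h
  · rw [hX t (by omega), map_zero, AddMonoidHom.zero_apply, smul_zero]
  · rfl

theorem markedRight_mem {m n k : ℕ} {a b c : ℤ} (i : ℕ) (hi : i < m) (hk : m + n = k + 1)
    (hc : a + b = c) (x : Q.obj m a) (Y : ℕ → Q.obj (n + 1) (b + 1)) :
    markedRight i hi hk hc x Y ∈ markedFamily Q k c :=
  fun _ _ => if_neg (by omega)

variable (Q)

/-- The square-zero extension of an operad by the operations with one input filled by a formal
symbol of arity `0` and degree `-1`. -/
def markedExtension : GrOperad.{u} where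
  obj n a := Q.obj n a × markedFamily Q n a
  one := (Q.one, 0)
  comp i hi hk hc := AddMonoidHom.mk' (fun x => AddMonoidHom.mk'
      (fun y => (Q.comp i hi hk hc x.1 y.1,
        ⟨markedLeft i hi hk hc x.2.1 y.1 + markedRight i hi hk hc x.1 y.2.1,
          add_mem (markedLeft_mem i hi hk hc x.2.2 y.1) (markedRight_mem i hi hk hc x.1 y.2.1)⟩))
      (by
        intro y y'
        refine Prod.ext (map_add _ _ _) (Subtype.ext ?_)
        simp only [Prod.fst_add, Prod.snd_add, AddSubgroup.coe_add, markedLeft_add_right,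
          markedRight_add_right]
        abel))
    (by
      intro x x'
      ext y : 1
      refine Prod.ext (by simp) (Subtype.ext ?_)
      simp only [Prod.fst_add, Prod.snd_add, AddSubgroup.coe_add, markedLeft_add,
        markedRight_add, AddMonoidHom.mk'_apply, AddMonoidHom.add_apply]
      abel)
  one_comp := by
    rintro n b ⟨y, Y⟩
    refine Prod.ext (Q.one_comp y) (Subtype.ext (funext fun t => ?_))
    simp only [AddMonoidHom.mk'_apply, Pi.add_apply, markedLeft, markedRight, AddSubgroup.coe_zero,
      Pi.zero_apply, map_zero, AddMonoidHom.zero_apply, smul_zero, ite_self, zero_add]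
    split_ifs with h
    · exact Q.one_comp _
    -- Composites vanish at indices beyond the inputs, so the unit law holds only for families
    -- supported on actual inputs; this is why `markedFamily` is needed.
    · exact (Y.2 t (by omega)).symm
  comp_one := by
    rintro m a i hi ⟨x, X⟩
    refine Prod.ext (Q.comp_one i hi x) (Subtype.ext (funext fun t => ?_))
    simp only [AddMonoidHom.mk'_apply, Pi.add_apply, markedLeft, markedRight, AddSubgroup.coe_zero,
      Pi.zero_apply, map_zero, ite_self, add_zero, ksign_of_even Even.zero, one_smul,
      Nat.add_sub_cancel]
    by_cases h : t ≤ i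
    · rw [if_pos h, if_neg (by omega), add_zero]
      exact Q.comp_one _ _ _
    · rw [if_neg h, if_pos (by omega), zero_add]
      exact Q.comp_one _ _ _
  comp_assoc := by
    rintro m n p k l r a b c e f g i j hi hj hij hk hr hl hr' he hg hf hg' ⟨x, X⟩ ⟨y, Y⟩ ⟨z, Z⟩
    refine Prod.ext (Q.comp_assoc i j hi hj hij hk hr hl hr' he hg hf hg' x y z)
      (Subtype.ext ?_)
    simp only [AddMonoidHom.mk'_apply, markedLeft_add, markedRight_add_right]
    rw [markedLeft_assoc i j hi hj hij hk hr hl hr' he hg hf hg',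
      markedLeft_markedRight_assoc i j hi hj hij hk hr hl hr' he hg hf hg',
      markedRight_assoc i j hi hj hij hk hr hl hr' he hg hf hg', add_assoc]
  comp_parallel := by
    rintro m n p k l r a b c e f g i j j' hlt hi hj hj' hjk hil hk hr hl hr' he hg hf hg'
      ⟨x, X⟩ ⟨y, Y⟩ ⟨z, Z⟩
    refine Prod.ext (Q.comp_parallel i j j' hlt hi hj hj' hjk hil hk hr hl hr' he hg hf hg' x y z)
      (Subtype.ext ?_)
    simp only [AddMonoidHom.mk'_apply, markedLeft_add, Prod.smul_snd, AddSubgroup.coe_zsmul,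
      smul_add]
    rw [markedLeft_parallel i j j' hlt hi hj hj' hjk hil hk hr hl hr' he hg hf hg',
      markedLeft_markedRight_parallel i j j' hlt hi hj hj' hjk hil hk hr hl hr' he hg hf hg',
      markedRight_parallel i j j' hlt hi hj hj' hjk hil hk hr hl hr' he hg hf hg']
    abel

end Marked

/-! ### Morphisms and sub-operads -/

theorem FreeOperad.hom_ext {X : ℕ → ℤ → Type u} {R : GrOperad.{u}}
    {f g : GrOperad.Hom (FreeOperad X) R}
    (h : ∀ {n : ℕ} {a : ℤ} (x : X n a), f.map (FreeOperad.gen x) = g.map (FreeOperad.gen x)) :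
    f = g := by
  suffices ∀ {n : ℕ} {a : ℤ} (x : Pre X n a),
      f.map (n := n) (a := a) (FreeObj.mk x) = g.map (n := n) (a := a) (FreeObj.mk x) by
    apply GrOperad.Hom.ext
    funext n a
    exact AddMonoidHom.ext
      (FreeObj.ind (p := fun x => f.map (n := n) (a := a) x = g.map (n := n) (a := a) x) this)
  intro n a x
  induction x with
  | gen x => exact h x
  | one => exact f.map_one.trans g.map_one.symm
  | comp i hi hk hc x y ihx ihy =>
    refine (f.map_comp i hi hk hc (FreeObj.mk x) (FreeObj.mk y)).trans (Eq.trans ?_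
      (g.map_comp i hi hk hc (FreeObj.mk x) (FreeObj.mk y)).symm)
    rw [ihx, ihy]
  | zero => exact (map_zero f.map).trans (map_zero g.map).symm
  | add x y ihx ihy =>
    exact (map_add f.map (FreeObj.mk x) (FreeObj.mk y)).trans ((congrArg₂ (· + ·) ihx ihy).trans
      (map_add g.map (FreeObj.mk x) (FreeObj.mk y)).symm)
  | neg x ihx =>
    exact (map_neg f.map (FreeObj.mk x)).trans ((congrArg (- ·) ihx).trans
      (map_neg g.map (FreeObj.mk x)).symm)

/-- The identity operation, in a degree equal to zero. -/
def GrOperad.unit (Q : GrOperad.{u}) {b : ℤ} (hb : 0 = b) : Q.obj 1 b := hb ▸ Q.one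

theorem GrOperad.comp_unit (Q : GrOperad.{u}) {m : ℕ} {a b : ℤ} (hb : 0 = b) (i : ℕ) (hi : i < m)
    (hc : a + b = a) (x : Q.obj m a) : Q.comp i hi rfl hc x (Q.unit hb) = x := by
  subst hb
  exact Q.comp_one i hi x

/-! ### The marked derivation of a coproduct -/

section Coproduct

variable {Q : GrOperad.{u}} {κ : Q.obj 0 (-1)} {Q₀ : SubOperad Q}

theorem exists_hom_of_isColimit
    (hQ : Limits.IsColimit (Limits.BinaryCofan.mk Q₀.incl (kappaHom Q κ))) {R : GrOperad.{u}}
    (f : GrOperad.Hom Q₀.toOperad R) (k : R.obj 0 (-1)) :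
    ∃ F : GrOperad.Hom Q R,
      (∀ {n : ℕ} {a : ℤ} (x : Q.obj n a) (hx : x ∈ Q₀.carrier n a), F.map x = f.map ⟨x, hx⟩) ∧
        F.map κ = k := by
  obtain ⟨F, h₁, h₂⟩ := Limits.BinaryCofan.IsColimit.desc' hQ f (kappaHom R k)
  refine ⟨F, fun x hx => ?_, ?_⟩
  · exact congrArg (fun G : GrOperad.Hom Q₀.toOperad R => G.map ⟨x, hx⟩) h₁
  · exact congrArg (fun G : GrOperad.Hom kappaOperad R => G.map (FreeOperad.gen KGen.kappa)) h₂

theorem hom_ext_of_isColimit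
    (hQ : Limits.IsColimit (Limits.BinaryCofan.mk Q₀.incl (kappaHom Q κ))) {R : GrOperad.{u}}
    {F G : GrOperad.Hom Q R}
    (h : ∀ {n : ℕ} {a : ℤ} (x : Q.obj n a), x ∈ Q₀.carrier n a → F.map x = G.map x)
    (hκ : F.map κ = G.map κ) : F = G := by
  refine Limits.BinaryCofan.IsColimit.hom_ext hQ (f := F) (g := G) ?_ ?_
  · apply GrOperad.Hom.ext
    funext n a
    exact AddMonoidHom.ext fun x => h x.1 x.2
  · refine FreeOperad.hom_ext fun x => ?_
    cases x
    exact hκ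

/-- The derivation of a coproduct `Q₀ ∨ [κ]` that vanishes on `Q₀` and replaces the occurrences of
`κ`, one at a time, by a marked input. -/
theorem exists_markedDerivation
    (hQ : Limits.IsColimit (Limits.BinaryCofan.mk Q₀.incl (kappaHom Q κ))) :
    ∃ D : ∀ {n : ℕ} {a : ℤ}, Q.obj n a →+ (ℕ → Q.obj (n + 1) (a + 1)),
      (∀ {n : ℕ} {a : ℤ} (x : Q.obj n a), x ∈ Q₀.carrier n a → D x = 0) ∧
      D κ 0 = Q.unit (neg_add_cancel 1).symm ∧
      ∀ {m n k : ℕ} {a b c : ℤ} (i : ℕ) (hi : i < m) (hk : m + n = k + 1) (hc : a + b = c)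
        (x : Q.obj m a) (y : Q.obj n b), D (Q.comp i hi hk hc x y) =
          markedLeft i hi hk hc (D x) y + markedRight i hi hk hc x (D y) := by
  let base : GrOperad.Hom (markedExtension Q) Q :=
    { map := AddMonoidHom.fst _ _
      map_one := rfl
      map_comp := fun _ _ _ _ _ _ => rfl }
  let triv : GrOperad.Hom Q₀.toOperad (markedExtension Q) :=
    { map := (AddMonoidHom.inl _ _).comp Q₀.incl.map
      map_one := rfl
      map_comp := by
        intro m n k a b c i hi hk hc x y
        refine Prod.ext rfl (Subtype.ext (funext fun t => ?_))
        change 0 = markedLeft i hi hk hc (fun _ => 0) _ t + markedRight i hi hk hc _ (fun _ => 0) t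
        simp [markedLeft, markedRight] }
  -- Replacing `κ` by a mark leaves the identity operation with its only input marked.
  let e : ℕ → Q.obj (0 + 1) (-1 + 1) := fun t => if t = 0 then Q.unit (neg_add_cancel 1).symm else 0
  have he : e ∈ markedFamily Q 0 (-1) := fun t ht => if_neg (by omega)
  obtain ⟨F, hF, hκ⟩ := exists_hom_of_isColimit hQ triv (κ, ⟨e, he⟩)
  -- The morphism `F` is a section of the projection, by the uniqueness part of the universal
  -- property. Its second component is then a derivation over the identity of `Q`.
  have hb : ∀ {n : ℕ} {a : ℤ} (x : Q.obj n a), (F.map x).1 = x := by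
    let G : GrOperad.Hom Q Q :=
      { map := base.map.comp F.map
        map_one := by simp [base.map_one, F.map_one]
        map_comp := by intros; simp [base.map_comp, F.map_comp] }
    let I : GrOperad.Hom Q Q :=
      { map := AddMonoidHom.id _
        map_one := rfl
        map_comp := fun _ _ _ _ _ _ => rfl }
    have hG : G = I := by
      refine hom_ext_of_isColimit hQ (fun x hx => ?_) ?_
      · exact congrArg Prod.fst (hF x hx)
      · exact congrArg Prod.fst hκ
    intro n a x
    exact congrArg (fun H : GrOperad.Hom Q Q => H.map x) hG
  refine ⟨fun {n a} => (markedFamily Q n a).subtype.comp ((AddMonoidHom.snd _ _).comp F.map),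
    fun x hx => ?_, ?_, ?_⟩
  · exact congrArg (fun z => z.2.1) (hF x hx)
  · exact congrArg (fun z => z.2.1 0) hκ
  · intro m n k a b c i hi hk hc x y
    have h := congrArg (fun z => z.2.1) (F.map_comp i hi hk hc x y)
    refine h.trans ?_
    change markedLeft i hi hk hc (F.map x).2.1 (F.map y).1 +
      markedRight i hi hk hc (F.map x).1 (F.map y).2.1 = _
    rw [hb, hb]
    rfl

end Coproduct

/-! ### Independence of insertions of `κ` -/

section Independence

variable {Q : GrOperad.{u}} {κ : Q.obj 0 (-1)} {Q₀ : SubOperad Q}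
  (D : ∀ {n : ℕ} {a : ℤ}, Q.obj n a →+ (ℕ → Q.obj (n + 1) (a + 1)))

/-- This is the Leibniz rule: the first two terms mark an occurrence of `κ` inside `x`, to the left
or to the right of the filled input, with the sign of the mark passing `κ`; the last one marks the
inserted `κ`. -/
theorem markedDerivation_comp_kappa (hκ : D κ 0 = Q.unit (neg_add_cancel 1).symm)
    (hD : ∀ {m n k : ℕ} {a b c : ℤ} (i : ℕ) (hi : i < m) (hk : m + n = k + 1) (hc : a + b = c)
        (x : Q.obj m a) (y : Q.obj n b), D (Q.comp i hi hk hc x y) =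
          markedLeft i hi hk hc (D x) y + markedRight i hi hk hc x (D y))
    {n : ℕ} {c : ℤ} (i : ℕ) (hi : i < n + 1) (hk : n + 1 + 0 = n + 1) (hc : c + 1 + -1 = c)
    (hi' : i + 1 < n + 1 + 1) (hi'' : i < n + 1 + 1) (hk' : n + 1 + 1 + 0 = n + 1 + 1)
    (hc' : c + 1 + 1 + -1 = c + 1) (x : Q.obj (n + 1) (c + 1)) (t : ℕ) :
    D (Q.comp i hi hk hc x κ) t =
      (if t ≤ i then - Q.comp (i + 1) hi' hk' hc' (D x t) κ else 0) +
        (if i ≤ t then - Q.comp i hi'' hk' hc' (D x (t + 1)) κ else 0) +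
        (if t = i then x else 0) := by
  rw [hD, Pi.add_apply, markedLeft, markedRight]
  simp only [ksign_neg_one, neg_smul, one_smul, add_zero, Nat.sub_zero]
  congr 1
  by_cases h : t = i
  · subst h
    simp only [le_refl, and_self, if_true, Nat.sub_self, hκ]
    exact Q.comp_unit _ t hi _ x
  · rw [if_neg h, if_neg (by omega)]

theorem markedDerivation_comp_kappa_of_mem
    (h₀ : ∀ {n : ℕ} {a : ℤ} (x : Q.obj n a), x ∈ Q₀.carrier n a → D x = 0) (hκ : D κ 0 = Q.unit (neg_add_cancel 1).symm)
    (hD : ∀ {m n k : ℕ} {a b c : ℤ} (i : ℕ) (hi : i < m) (hk : m + n = k + 1) (hc : a + b = c)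
        (x : Q.obj m a) (y : Q.obj n b), D (Q.comp i hi hk hc x y) =
          markedLeft i hi hk hc (D x) y + markedRight i hi hk hc x (D y))
    {n : ℕ} {c : ℤ} (i : ℕ) (hi : i < n + 1) (hk : n + 1 + 0 = n + 1) (hc : c + 1 + -1 = c)
    {x : Q.obj (n + 1) (c + 1)} (hx : x ∈ Q₀.carrier _ _) (t : ℕ) :
    D (Q.comp i hi hk hc x κ) t = if t = i then x else 0 := by
  rw [markedDerivation_comp_kappa D hκ hD i hi hk hc (by omega) (by omega) (by omega) (by omega),
    h₀ x hx]
  simp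

variable (hQ : Limits.IsColimit (Limits.BinaryCofan.mk Q₀.incl (kappaHom Q κ)))
include hQ

/-- Filling one input by `κ` is injective on `Q₀`, even after summation over all the inputs. -/
theorem eq_zero_of_sum_comp_kappa {n : ℕ} {b c : ℤ} (hk : n + 1 + 0 = n + 1) (hc : b + -1 = c)
    {x : Q.obj (n + 1) b} (hx : x ∈ Q₀.carrier _ _)
    (h : ∑ i : Fin (n + 1), Q.comp (i : ℕ) i.2 hk hc x κ = 0) : x = 0 := by
  obtain rfl : b = c + 1 := by omega
  obtain ⟨D, h₀, hκ, hD⟩ := exists_markedDerivation hQ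
  -- At mark `0` only the summand `i = 0` survives, and its value is `x`.
  have h' := congrArg (fun z => D z 0) h
  simp only [map_sum, Finset.sum_apply, map_zero, Pi.zero_apply,
    markedDerivation_comp_kappa_of_mem D h₀ hκ hD _ _ _ _ hx] at h'
  rw [Finset.sum_eq_single (0 : Fin (n + 1))] at h'
  · simpa using h'
  · intro i _ hi
    rw [if_neg]
    exact fun h => hi (Fin.ext h.symm)
  · simp

/-- If the insertions of `κ` into the inputs of an operation of weight at most one sum up to zero,
then its part of weight zero vanishes and its part of weight one is symmetric. -/
theorem eq_of_sum_comp_kappa_add_comp_kappa {n : ℕ} {a b c : ℤ} (hk : n + 1 + 0 = n + 1)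
    (hk' : n + 1 + 1 + 0 = n + 1 + 1) (hb : a + -1 = b)
    (hc : b + -1 = c) {x : Q.obj (n + 1) b} (hx : x ∈ Q₀.carrier _ _)
    {y : Fin (n + 1 + 1) → Q.obj (n + 1 + 1) a} (hy : ∀ i, y i ∈ Q₀.carrier _ _)
    (h : ∑ p : Fin (n + 1), Q.comp (p : ℕ) p.2 hk hc
      (x + ∑ i : Fin (n + 1 + 1), Q.comp (i : ℕ) i.2 hk' hb (y i) κ) κ = 0) :
    x = 0 ∧ ∀ i, y i = y 0 := by
  obtain rfl : a = b + 1 := by omega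
  obtain rfl : b = c + 1 := by omega
  obtain ⟨D, h₀, hκ, hD⟩ := exists_markedDerivation hQ
  -- The retraction `π` fixes `Q₀` and kills `κ`; it extracts the weight zero part.
  obtain ⟨π, hπ, hπκ⟩ := exists_hom_of_isColimit hQ Q₀.incl 0
  set E := x + ∑ i : Fin (n + 1 + 1), Q.comp (i : ℕ) i.2 hk' hb (y i) κ with hE
  have hDE : ∀ i : Fin (n + 1 + 1), D E i = y i := by
    intro i
    simp only [hE, map_add, map_sum, Pi.add_apply, Finset.sum_apply, h₀ x hx, Pi.zero_apply,
      zero_add, markedDerivation_comp_kappa_of_mem D h₀ hκ hD _ _ _ _ (hy _)]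
    rw [Finset.sum_eq_single i]
    · simp
    · intro j _ hj
      rw [if_neg]
      exact fun h => hj (Fin.ext h.symm)
    · simp
  -- At mark `0` the relation becomes `E = ∑_p y 0 ∘_{p+1} κ + y 1 ∘_0 κ`. Applying `π` leaves `x =
  -- 0`.
  have h' := congrArg (fun z => D z 0) h
  simp only [map_sum, Finset.sum_apply, map_zero, Pi.zero_apply,
    markedDerivation_comp_kappa D hκ hD _ _ _ _ (Nat.succ_lt_succ (Fin.is_lt _))
      (Nat.lt_succ_of_lt (Fin.is_lt _)) hk' hb] at h'
  have hx0 : x = 0 := by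
    have hπE : π.map E = x := by
      simp only [hE, map_add, map_sum, π.map_comp, hπκ, map_zero, Finset.sum_const_zero, add_zero,
        hπ x hx]
      rfl
    have h'' := congrArg π.map h'
    simp only [map_sum, map_add, apply_ite π.map, map_neg, π.map_comp, hπκ, map_zero, neg_zero,
      ite_self, zero_add, hπE] at h''
    rw [Finset.sum_eq_single (0 : Fin (n + 1))] at h''
    · simpa using h''
    · intro i _ hi
      rw [if_neg]
      exact fun h => hi (Fin.ext h.symm)
    · simp
  refine ⟨hx0, fun s => ?_⟩
  refine Fin.cases rfl (fun s => ?_) s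
  -- A second mark, at `s + 1`, reads off coefficients: `- y 0` from the term `p = s`, nothing from
  -- `y 1 ∘_0 κ`, which is marked only at `0`, and `y s.succ` from `E`.
  have h'' := congrArg (fun z => D z (s + 1 : ℕ)) h'
  have e0 : D E 0 = y 0 := hDE 0
  have e1 : D E (0 + 1) = y 1 := hDE 1
  have es : D E (s + 1 : ℕ) = y s.succ := hDE s.succ
  simp only [map_sum, Finset.sum_apply, map_zero, Pi.zero_apply, map_add, Pi.add_apply, e0, e1,
    zero_le, if_true, Finset.sum_add_distrib, map_neg, Pi.neg_apply,
    markedDerivation_comp_kappa_of_mem D h₀ hκ hD _ _ _ _ (hy _)] at h''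
  have s0 : ∑ p : Fin (n + 1), -(if (s : ℕ) + 1 = p + 1 then y 0 else 0) = - y 0 := by
    rw [Finset.sum_eq_single s]
    · simp
    · intro i _ hi
      rw [if_neg, neg_zero]
      exact fun h => hi (Fin.ext (Nat.succ_injective h).symm)
    · simp
  have s1 : ∑ p : Fin (n + 1), D (if (p : ℕ) ≤ 0 then
      - Q.comp (p : ℕ) (Nat.lt_succ_of_lt p.2) hk' hb (y 1) κ else 0) (s + 1) = 0 := by
    refine Finset.sum_eq_zero fun p _ => ?_
    split_ifs with hp
    · rw [map_neg, Pi.neg_apply, markedDerivation_comp_kappa_of_mem D h₀ hκ hD _ _ _ _ (hy _),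
        if_neg (by omega), neg_zero]
    · rw [map_zero, Pi.zero_apply]
  have s2 : ∑ p : Fin (n + 1), D (if 0 = (p : ℕ) then E else 0) (s + 1) = y s.succ := by
    rw [Finset.sum_eq_single 0]
    · simpa using es
    · intro i _ hi
      rw [if_neg, map_zero, Pi.zero_apply]
      exact fun h => hi (Fin.ext h.symm)
    · simp
  rw [s0, s1, s2, add_zero] at h''
  exact (neg_add_eq_zero.mp h'').symm

end Independence

/-! ### Operations of weight zero and one -/

section Weight

variable {Q : GrOperad.{u}} (κ : Q.obj 0 (-1)) (Q₀ : SubOperad Q)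

/-- The sums of operations of `Q₀` with one input filled by `κ`. -/
def kappaSpan (n : ℕ) (b : ℤ) : AddSubgroup (Q.obj n b) where
  carrier := {x | ∃ y : Fin (n + 1) → Q.obj (n + 1) (b + 1), (∀ i, y i ∈ Q₀.carrier _ _) ∧
    x = ∑ i : Fin (n + 1), Q.comp (i : ℕ) i.2 (Nat.add_zero _) (add_neg_cancel_right b 1) (y i) κ}
  zero_mem' := ⟨0, fun _ => zero_mem _, by simp⟩
  add_mem' := by
    rintro _ _ ⟨y, hy, rfl⟩ ⟨z, hz, rfl⟩
    exact ⟨y + z, fun i => add_mem (hy i) (hz i), by simp [Finset.sum_add_distrib]⟩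
  neg_mem' := by
    rintro _ ⟨y, hy, rfl⟩
    exact ⟨-y, fun i => neg_mem (hy i), by simp⟩

variable {κ Q₀}

theorem exists_of_mem_kappaSpan {n : ℕ} {a b : ℤ} (hk : n + 1 + 0 = n + 1) (hb : a + -1 = b)
    {x : Q.obj n b} (hx : x ∈ kappaSpan κ Q₀ n b) :
    ∃ y : Fin (n + 1) → Q.obj (n + 1) a, (∀ i, y i ∈ Q₀.carrier _ _) ∧
      x = ∑ i : Fin (n + 1), Q.comp (i : ℕ) i.2 hk hb (y i) κ := by
  obtain rfl : a = b + 1 := by omega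
  exact hx

theorem comp_kappa_mem_kappaSpan {m n : ℕ} {a b : ℤ} (i : ℕ) (hi : i < m) (hk : m + 0 = n + 1)
    (hb : a + -1 = b) {x : Q.obj m a} (hx : x ∈ Q₀.carrier m a) :
    Q.comp i hi hk hb x κ ∈ kappaSpan κ Q₀ n b := by
  obtain rfl : m = n + 1 := hk
  obtain rfl : a = b + 1 := by omega
  refine ⟨fun j => if j = i then x else 0, fun j => ?_, ?_⟩
  · dsimp only
    split_ifs
    exacts [hx, zero_mem _]
  · rw [Finset.sum_eq_single ⟨i, hi⟩]
    · simp
    · intro j _ hj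
      dsimp only
      rw [if_neg, map_zero, AddMonoidHom.zero_apply]
      exact fun h => hj (Fin.ext h)
    · simp

theorem comp_mem_kappaSpan_right {m n k : ℕ} {a b c : ℤ} (i : ℕ) (hi : i < m) (hk : m + n = k + 1)
    (hc : a + b = c) {x : Q.obj m a} (hx : x ∈ Q₀.carrier m a) {y : Q.obj n b}
    (hy : y ∈ kappaSpan κ Q₀ n b) : Q.comp i hi hk hc x y ∈ kappaSpan κ Q₀ k c := by
  obtain ⟨y, hy, rfl⟩ := hy
  rw [map_sum]
  refine sum_mem fun j _ => ?_
  rw [← Q.comp_assoc (k := k + 1) (e := c + 1) i j hi j.2 (by omega) (by omega) (by omega) (by omega)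
    (by omega) (by omega) (by omega) (by omega) (by omega)]
  exact comp_kappa_mem_kappaSpan _ _ _ _ (Q₀.comp_mem _ _ _ _ hx (hy j))

/-- Grafting `y` into one input and `κ` into another commute up to sign, so `κ` can always be
inserted last, into an element of `Q₀`. If `κ` fills an input `j ≤ i`, input `i` of the result is
input `i + 1` of the original operation. -/
theorem comp_mem_kappaSpan_left {m n k : ℕ} {a b c : ℤ} (i : ℕ) (hi : i < m) (hk : m + n = k + 1)
    (hc : a + b = c) {x : Q.obj m a} (hx : x ∈ kappaSpan κ Q₀ m a) {y : Q.obj n b}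
    (hy : y ∈ Q₀.carrier n b) : Q.comp i hi hk hc x y ∈ kappaSpan κ Q₀ k c := by
  obtain ⟨x, hx, rfl⟩ := hx
  rw [map_sum, AddMonoidHom.finsetSum_apply]
  refine sum_mem fun j _ => ?_
  rcases le_or_gt (j : ℕ) i with hj | hj
  · rw [Q.comp_parallel (l := k + 1) (f := c + 1) j (i + 1) i (by omega) (by omega) (by omega)
      (by omega) (by omega) (by omega) (by omega) (by omega) (by omega) (by omega) (by omega)
      (by omega) (by omega) (by omega)]
    exact zsmul_mem (comp_kappa_mem_kappaSpan _ _ _ _ (Q₀.comp_mem _ _ _ _ (hx j) hy)) _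
  · have h := Q.comp_parallel (k := k + 1) (e := c + 1) (r := k) (g := c) i j (j + n - 1) hj
      (by omega) j.2 (by omega) (by omega) hi (by omega) (by omega) (Nat.add_zero _) hk (by omega)
      (by omega) (add_neg_cancel_right a 1) hc (x j) y κ
    have h' := congrArg (ksign (b * -1) • ·) h
    simp only [smul_smul, ksign_mul_self, one_smul] at h'
    rw [← h']
    exact zsmul_mem (comp_kappa_mem_kappaSpan _ _ _ _ (Q₀.comp_mem _ _ _ _ (hx j) hy)) _

/-- Normal form in the two weights needed: in a composite of weight one, exactly one factor has
weight one and the other lies in `Q₀`. -/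
theorem IsMonomial.mem {w n : ℕ} {a : ℤ} {x : Q.obj n a} (h : IsMonomial κ Q₀ w x) :
    (w = 0 → x ∈ Q₀.carrier n a) ∧ (w = 1 → x ∈ kappaSpan κ Q₀ n a) := by
  induction h with
  | base hx => exact ⟨fun _ => hx, by simp⟩
  | kappa =>
    refine ⟨by simp, fun _ => ?_⟩
    -- Write `κ` as the identity operation with its input filled by `κ`.
    have h := comp_kappa_mem_kappaSpan (κ := κ) (n := 0) 0 Nat.one_pos rfl (zero_add _) Q₀.one_mem
    rwa [Q.one_comp κ] at h
  | @comp v w _ _ _ _ _ _ i hi hk hc x y _ _ ihx ihy =>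
    refine ⟨fun h => ?_, fun h => ?_⟩
    · exact Q₀.comp_mem i hi hk hc (ihx.1 (by omega)) (ihy.1 (by omega))
    · rcases Nat.eq_zero_or_pos v with hv | hv
      · exact comp_mem_kappaSpan_right i hi hk hc (ihx.1 hv) (ihy.2 (by omega))
      · exact comp_mem_kappaSpan_left i hi hk hc (ihx.2 (by omega)) (ihy.1 (by omega))

theorem weightPart_zero_le (n : ℕ) (a : ℤ) : weightPart κ Q₀ 0 n a ≤ Q₀.carrier n a :=
  (AddSubgroup.closure_le _).mpr fun _ hx => (IsMonomial.mem hx).1 rfl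

theorem weightPart_one_le (n : ℕ) (a : ℤ) : weightPart κ Q₀ 1 n a ≤ kappaSpan κ Q₀ n a :=
  (AddSubgroup.closure_le _).mpr fun _ hx => (IsMonomial.mem hx).2 rfl

end Weight

section Curved

variable {Q : DGOperad.{u}} {κ : Q.obj 0 (-1)} {Q₀ : SubOperad Q.toGrOperad}

theorem IsCurved.d_eq_add (hQ : IsCurved Q κ Q₀) {n : ℕ} {a b : ℤ} (h : b + 1 = a) {x : Q.obj n a}
    (hx : x ∈ Q₀.carrier n a) :
    ∃ y ∈ Q₀.carrier n b, ∃ z ∈ kappaSpan κ Q₀ n b, Q.d h x = y + z := by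
  obtain ⟨d₀, d₁, hd, h₀, h₁, -⟩ := hQ.strictMixed
  have hw : x ∈ weightPart κ Q₀ 0 n a := AddSubgroup.subset_closure (IsMonomial.base hx)
  exact ⟨_, weightPart_zero_le _ _ (h₀ h 0 x hw), _, weightPart_one_le _ _ (h₁ h 0 x hw), hd h x⟩

/-- This is where `d₁ κ = 0` enters: `d κ` reduces to `d₀ κ`, of the same weight one as `κ`. -/
theorem IsCurved.d_kappa_mem (hQ : IsCurved Q κ Q₀) {b : ℤ} (h : b + 1 = -1) :
    Q.d h κ ∈ kappaSpan κ Q₀ 0 b := by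
  obtain ⟨d₀, d₁, hd, h₀, -, hκ⟩ := hQ.strictMixed
  have hw : κ ∈ weightPart κ Q₀ 1 0 (-1) := AddSubgroup.subset_closure IsMonomial.kappa
  rw [hd, hκ, add_zero]
  exact weightPart_one_le _ _ (h₀ h 1 κ hw)

end Curved

/-! ### Evaluating the curved A-infinity operad -/

section Eval

variable {Q : DGOperad.{u}}

/-- The family of operations `m`, as a function on the generators `μ_n`. -/
def muFamily {Q : GrOperad.{u}} (m : ∀ n, Q.obj n (-1)) :
    ∀ {n : ℕ} {a : ℤ}, CAGen.{u} n a → Q.obj n a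
  | _, _, .mu n => m n

/-- The morphism of graded operads sending `μ_n` to `m n`. -/
def evalMu {Q : GrOperad.{u}} (m : ∀ n, Q.obj n (-1)) : GrOperad.Hom (FreeOperad CAGen.{u}) Q :=
  FreeOperad.lift Q (muFamily m)

theorem hom_muDiff {Q : GrOperad.{u}} (f : GrOperad.Hom (FreeOperad CAGen.{u}) Q) (n : ℕ)
    (b : ℤ) (hb : b + 1 = -1) (hc : -1 + -1 = b) :
    f.map (n := n) (a := b) (muDiff n b hb) =
      - ∑ q : Fin (n + 1), ∑ p : Fin (n + 1 - q), Q.comp (k := n) (p : ℕ) p.2 (by omega) hc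
          (f.map (n := n + 1 - q) (a := -1) (mu (n + 1 - q))) (f.map (n := q) (a := -1) (mu q)) := by
  let φ : FreeObj CAGen.{u} n b →+ Q.obj n b := f.map
  change φ (muDiff n b hb) = _
  rw [muDiff, map_neg, map_sum]
  congr 1
  refine Finset.sum_congr rfl fun q _ => ?_
  rw [map_sum]
  exact Finset.sum_congr rfl fun p _ => f.map_comp _ _ _ _ _ _

/-- The part of `∑_{p+q+r=n} m_{p+1+r} ∘_{p+1} m_q` with `q > 0`. -/
def posSum {Q : GrOperad.{u}} (m : ∀ n, Q.obj n (-1)) (n : ℕ) {b : ℤ} (hc : -1 + -1 = b) :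
    Q.obj n b :=
  ∑ q : Fin n, ∑ p : Fin (n + 1 - (q + 1)),
    Q.comp (p : ℕ) p.2 (by omega) hc (m (n + 1 - (q + 1))) (m (q + 1))

/-- Splitting off `q = 0` isolates the only terms that contain `m (n + 1)`. -/
theorem evalMu_muDiff {Q : GrOperad.{u}} (m : ∀ n, Q.obj n (-1)) (n : ℕ) (b : ℤ)
    (hb : b + 1 = -1) (hc : -1 + -1 = b) (hk : n + 1 + 0 = n + 1) :
    (evalMu m).map (n := n) (a := b) (muDiff n b hb) =
      - (∑ p : Fin (n + 1), Q.comp (p : ℕ) p.2 hk hc (m (n + 1)) (m 0) + posSum m n hc) := by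
  rw [hom_muDiff _ n b hb hc, Fin.sum_univ_succ]
  rfl

theorem posSum_congr {Q : GrOperad.{u}} {m m' : ∀ n, Q.obj n (-1)} {n : ℕ}
    (h : ∀ k, k ≤ n → m k = m' k) {b : ℤ} (hc : -1 + -1 = b) : posSum m n hc = posSum m' n hc := by
  refine Finset.sum_congr rfl fun q _ => Finset.sum_congr rfl fun p _ => ?_
  rw [h _ (by omega), h _ (by omega)]

theorem posSum_mem {Q : GrOperad.{u}} {Q₀ : SubOperad Q} {m : ∀ n, Q.obj n (-1)}
    (h : ∀ k, 0 < k → m k ∈ Q₀.carrier k (-1)) (n : ℕ) {b : ℤ} (hc : -1 + -1 = b) :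
    posSum m n hc ∈ Q₀.carrier n b :=
  sum_mem fun q _ => sum_mem fun _ _ =>
    Q₀.comp_mem _ _ _ _ (h _ (by omega)) (h _ (Nat.succ_pos _))

theorem evalMu_muDiff_congr {Q : GrOperad.{u}} {m m' : ∀ n, Q.obj n (-1)} {n : ℕ}
    (h : ∀ k, k ≤ n + 1 → m k = m' k) (b : ℤ) (hb : b + 1 = -1) :
    (evalMu m).map (n := n) (a := b) (muDiff n b hb) =
      (evalMu m').map (n := n) (a := b) (muDiff n b hb) := by
  rw [evalMu_muDiff m n b hb (by omega) rfl, evalMu_muDiff m' n b hb (by omega) rfl,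
    posSum_congr fun k hk => h k (by omega), h _ le_rfl, h 0 (by omega)]

/-- If `m` is compatible with the differentials of `μ_0, …, μ_n`, then the defect of compatibility
at `μ_{n+1}` is annihilated by the sum of the insertions of `m 0`. -/
theorem sum_comp_defect (m : ∀ n, Q.obj n (-1)) (n : ℕ) {b c : ℤ} (hb : b + 1 = -1)
    (hc : c + 1 = b) (hk : n + 1 + 0 = n + 1) (hbc : b + -1 = c)
    (hm : ∀ q, q ≤ n → Q.d hb (m q) = (evalMu m).map (n := q) (a := b) (muDiff q b hb)) :
    ∑ p : Fin (n + 1), Q.comp (p : ℕ) p.2 hk hbc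
      (Q.d hb (m (n + 1)) - (evalMu m).map (n := n + 1) (a := b) (muDiff (n + 1) b hb)) (m 0) =
        0 := by
  have hbb : -1 + -1 = b := by omega
  have hbc' : -1 + b = c := by omega
  -- Two computations of zero: `h₁` uses `d² = 0` in `Q`, `h₂` uses it in `cAInf`. They expand into
  -- the same double sum, except that `d (m k)` in one stands where the image of `d μ_k` stands in
  -- the other.
  have h₁ : Q.d hc ((evalMu m).map (n := n) (a := b) (muDiff n b hb)) = 0 := by
    rw [← hm n le_rfl, Q.d_d]
  have h₂ : (evalMu m).map (n := n) (a := c)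
      (FreeObj.deriv caGenDiff.{u} hc (muDiff n b hb)) = 0 :=
    (congrArg (evalMu m).map (caGenDiff_sq (CAGen.mu n) b c hb hc)).trans (map_zero _)
  have e₁ : Q.d hc ((evalMu m).map (n := n) (a := b) (muDiff n b hb)) =
      - ∑ q : Fin (n + 1), ∑ p : Fin (n + 1 - q),
        (Q.comp (k := n) (p : ℕ) p.2 (by omega) hbc (Q.d hb (m (n + 1 - q))) (m q) -
          Q.comp (k := n) (p : ℕ) p.2 (by omega) hbc' (m (n + 1 - q)) (Q.d hb (m q))) := by
    rw [hom_muDiff _ n b hb hbb, map_neg, map_sum]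
    congr 1
    refine Finset.sum_congr rfl fun q _ => ?_
    rw [map_sum]
    refine Finset.sum_congr rfl fun p _ => ?_
    rw [Q.d_comp (p : ℕ) p.2 _ hbb hb hb hc hbc hbc', ksign_neg_one, neg_smul, one_smul,
      sub_eq_add_neg]
    rfl
  have e₂ : (evalMu m).map (n := n) (a := c)
      (FreeObj.deriv caGenDiff.{u} hc (muDiff n b hb)) =
      - ∑ q : Fin (n + 1), ∑ p : Fin (n + 1 - q),
        (Q.comp (k := n) (p : ℕ) p.2 (by omega) hbc
            ((evalMu m).map (n := n + 1 - q) (a := b) (muDiff (n + 1 - q) b hb)) (m q) -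
          Q.comp (k := n) (p : ℕ) p.2 (by omega) hbc' (m (n + 1 - q))
            ((evalMu m).map (n := q) (a := b) (muDiff q b hb))) := by
    let φ : FreeObj CAGen.{u} n c →+ Q.obj n c := (evalMu m).map
    change φ _ = _
    rw [muDiff, map_neg, map_neg, map_sum, map_sum]
    congr 1
    refine Finset.sum_congr rfl fun q _ => ?_
    rw [map_sum, map_sum]
    refine Finset.sum_congr rfl fun p _ => ?_
    rw [FreeObj.deriv_comp caGenDiff (p : ℕ) p.2 _ _ hb hb hc hbc hbc', deriv_mu, deriv_mu,
      ksign_neg_one, neg_smul, one_smul, map_add, map_neg, sub_eq_add_neg]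
    exact congrArg₂ (fun x y => x + -y) ((evalMu m).map_comp _ _ _ _ _ _)
      ((evalMu m).map_comp _ _ _ _ _ _)
  -- In the difference, the terms that differentiate the inserted factor cancel, since that factor
  -- has index `q ≤ n`.
  have key : ∑ q : Fin (n + 1), ∑ p : Fin (n + 1 - q), Q.comp (k := n) (p : ℕ) p.2 (by omega) hbc
      (Q.d hb (m (n + 1 - q)) -
        (evalMu m).map (n := n + 1 - q) (a := b) (muDiff (n + 1 - q) b hb)) (m q) = 0 := by
    rw [e₁, neg_eq_zero] at h₁
    rw [e₂, neg_eq_zero] at h₂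
    rw [← sub_zero (0 : Q.obj n c)]
    nth_rewrite 1 [← h₁]
    rw [← h₂, ← Finset.sum_sub_distrib]
    refine Finset.sum_congr rfl fun q _ => ?_
    rw [← Finset.sum_sub_distrib]
    refine Finset.sum_congr rfl fun p _ => ?_
    rw [hm q (by omega), map_sub, AddMonoidHom.sub_apply]
    abel
  rw [Fin.sum_univ_succ] at key
  -- For positive `q` the outer factor has index at most `n`, so its defect vanishes; only the
  -- insertions of `m 0` remain.
  have rest : ∑ q : Fin n, ∑ p : Fin (n + 1 - q.succ),
      Q.comp (k := n) (p : ℕ) p.2 (by omega) hbc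
        (Q.d hb (m (n + 1 - q.succ)) -
          (evalMu m).map (n := n + 1 - q.succ) (a := b) (muDiff (n + 1 - q.succ) b hb))
        (m q.succ) = 0 := by
    refine Finset.sum_eq_zero fun q _ => Finset.sum_eq_zero fun p _ => ?_
    rw [hm (n + 1 - q.succ) (by simp), sub_self, map_zero, AddMonoidHom.zero_apply]
  rw [rest, add_zero] at key
  exact key

/-- A morphism out of the curved A-infinity operad is compatible with the differentials as soon as
it is so on the generators. -/
theorem evalMu_deriv {m : ∀ n, Q.obj n (-1)}
    (hm : ∀ (n : ℕ) (b : ℤ) (hb : b + 1 = -1),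
      Q.d hb (m n) = (evalMu m).map (n := n) (a := b) (muDiff n b hb))
    {n : ℕ} {a b : ℤ} (h : b + 1 = a) (x : FreeObj CAGen.{u} n a) :
    (evalMu m).map (n := n) (a := b) (FreeObj.deriv caGenDiff.{u} h x) =
      Q.d h ((evalMu m).map (n := n) (a := a) x) := by
  -- The derivation rule on `1 ∘ 1` gives `d 1 = d 1 + d 1`.
  have d_one : ∀ {b : ℤ} (h : b + 1 = 0), Q.d h Q.one = 0 := by
    intro b h
    have h' := Q.d_comp 0 Nat.one_pos rfl (zero_add 0) h h h (add_zero b) (zero_add b) Q.one Q.one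
    rw [Q.comp_one, Q.one_comp, Q.comp_one, ksign_of_even Even.zero, one_smul] at h'
    simpa using h'
  induction x using FreeObj.ind with
  | h x =>
    induction x generalizing b with
    | gen x =>
      cases x with
      | mu => exact (hm _ b h).symm
    | one => exact (map_zero (evalMu m).map).trans (d_one h).symm
    | @comp m' n' k' a₁ a₂ a₃ i hi hk hc x y ihx ihy =>
      rw [FreeObj.mk_comp, FreeObj.deriv_comp caGenDiff i hi hk hc (a' := a₁ - 1) (b' := a₂ - 1)
        (by omega) (by omega) h (by omega) (by omega)]
      let φ : FreeObj CAGen.{u} k' b →+ Q.obj k' b := (evalMu m).map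
      refine (map_add φ _ _).trans ?_
      rw [map_zsmul]
      refine Eq.trans ?_ (congrArg (Q.d h) ((evalMu m).map_comp i hi hk hc (FreeObj.mk x)
        (FreeObj.mk y)).symm)
      rw [Q.d_comp i hi hk hc (a' := a₁ - 1) (b' := a₂ - 1) (by omega) (by omega) h (by omega)
        (by omega), ← ihx, ← ihy]
      exact congrArg₂ (fun x y => x + ksign a₁ • y) ((evalMu m).map_comp _ _ _ _ _ _)
        ((evalMu m).map_comp _ _ _ _ _ _)
    | @zero n a =>
      let φ : ∀ {b : ℤ}, FreeObj CAGen.{u} n b →+ Q.obj n b := (evalMu m).map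
      change φ (FreeObj.deriv _ h 0) = Q.d h (φ 0)
      rw [map_zero, map_zero, map_zero, map_zero]
    | @add n a x y ihx ihy =>
      let φ : ∀ {b : ℤ}, FreeObj CAGen.{u} n b →+ Q.obj n b := (evalMu m).map
      change φ (FreeObj.deriv _ h (FreeObj.mk x + FreeObj.mk y)) =
        Q.d h (φ (FreeObj.mk x + FreeObj.mk y))
      rw [map_add, map_add, map_add, map_add]
      exact congrArg₂ (· + ·) (ihx h) (ihy h)
    | @neg n a x ihx =>
      let φ : ∀ {b : ℤ}, FreeObj CAGen.{u} n b →+ Q.obj n b := (evalMu m).map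
      change φ (FreeObj.deriv _ h (- FreeObj.mk x)) = Q.d h (φ (- FreeObj.mk x))
      rw [map_neg, map_neg, map_neg, map_neg]
      exact congrArg (- ·) (ihx h)

end Eval

/-! ### Morphisms from the curved A-infinity operad to a curved operad -/

section Existence

variable {Q : DGOperad.{u}} {κ : Q.obj 0 (-1)} {Q₀ : SubOperad Q.toGrOperad}

/-- One step of the recursion: the `y` found here is to become `m (n + 1)`. The current value `m (n
+ 1)` is an arbitrary element of `Q₀` and drops out. -/
theorem IsCurved.exists_next (hQ : IsCurved Q κ Q₀) {m : ∀ n, Q.obj n (-1)} (h₀ : m 0 = κ)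
    (hpos : ∀ k, 0 < k → m k ∈ Q₀.carrier k (-1)) {b : ℤ} (hb : b + 1 = -1) (hc : -1 + -1 = b)
    (n : ℕ) (hk : n + 1 + 0 = n + 1)
    (hm : ∀ q, q < n → Q.d hb (m q) = (evalMu m).map (n := q) (a := b) (muDiff q b hb)) :
    ∃ y ∈ Q₀.carrier (n + 1) (-1), Q.d hb (m n) =
      - (∑ p : Fin (n + 1), Q.comp (p : ℕ) p.2 hk hc y κ + posSum m n hc) := by
  obtain ⟨hcol⟩ := hQ.isCoproduct
  cases n with
  | zero =>
    obtain ⟨y, hy, he⟩ := exists_of_mem_kappaSpan hk hc (hQ.d_kappa_mem hb)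
    refine ⟨- y 0, neg_mem (hy 0), ?_⟩
    rw [h₀, he]
    simp [posSum]
  | succ n =>
    obtain ⟨x, hx, z, hz, he⟩ := hQ.d_eq_add hb (hpos (n + 1) n.succ_pos)
    obtain ⟨y, hy, rfl⟩ := exists_of_mem_kappaSpan hk hc hz
    have hs := sum_comp_defect m n hb (sub_add_cancel b 1) rfl (sub_eq_add_neg b 1).symm
      fun q hq => hm q (by omega)
    have hE : Q.d hb (m (n + 1)) - (evalMu m).map (n := n + 1) (a := b) (muDiff (n + 1) b hb) =
        (x + posSum m (n + 1) hc) + ∑ i : Fin (n + 1 + 1), Q.comp (i : ℕ) i.2 hk hc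
          (y i + m (n + 1 + 1)) κ := by
      rw [he, evalMu_muDiff m (n + 1) b hb hc hk, h₀]
      simp only [map_add, AddMonoidHom.add_apply, Finset.sum_add_distrib]
      abel
    rw [hE, h₀] at hs
    obtain ⟨hx0, hy0⟩ := eq_of_sum_comp_kappa_add_comp_kappa hcol _ hk hc _
      (add_mem hx (posSum_mem hpos _ hc)) (fun i => add_mem (hy i) (hpos _ (Nat.succ_pos _))) hs
    refine ⟨- y 0, neg_mem (hy 0), ?_⟩
    rw [he, eq_neg_of_add_eq_zero_left hx0]
    -- The symmetry was obtained for `y i + m (n + 1 + 1)`; the provisional value is independent of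
    -- `i` and cancels.
    have : ∀ i, y i = y 0 := fun i => add_right_cancel (hy0 i)
    simp only [this, map_neg, AddMonoidHom.neg_apply, Finset.sum_neg_distrib]
    abel

theorem IsCurved.exists_family (hQ : IsCurved Q κ Q₀) {b : ℤ} (hb : b + 1 = -1) :
    ∃ m : ∀ n, Q.obj n (-1), m 0 = κ ∧ (∀ k, 0 < k → m k ∈ Q₀.carrier k (-1)) ∧
      ∀ n, Q.d hb (m n) = (evalMu m).map (n := n) (a := b) (muDiff n b hb) := by
  have hc : -1 + -1 = b := by omega
  -- Stage `n` consists of whole families satisfying the equations below `n`; passing to the next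
  -- stage may change only values above index `n`.
  let S (n : ℕ) : Type u := {m : ∀ n, Q.obj n (-1) // m 0 = κ ∧
    (∀ k, 0 < k → m k ∈ Q₀.carrier k (-1)) ∧
      ∀ q, q < n → Q.d hb (m q) = (evalMu m).map (n := q) (a := b) (muDiff q b hb)}
  have step : ∀ (n : ℕ) (m : S n), ∃ m' : S (n + 1), ∀ k, k ≤ n → m'.1 k = m.1 k := by
    rintro n ⟨m, h₀, hpos, hm⟩
    obtain ⟨y, hy, he⟩ := hQ.exists_next h₀ hpos hb hc n rfl hm
    have hu : ∀ k, k ≤ n → Function.update m (n + 1) y k = m k := fun k hk =>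
      Function.update_of_ne (by omega) _ _
    refine ⟨⟨Function.update m (n + 1) y, (hu 0 (Nat.zero_le n)).trans h₀, fun k hk => ?_,
      fun q hq => ?_⟩, hu⟩
    · by_cases h : k = n + 1
      · subst h
        rwa [Function.update_self]
      · rw [Function.update_of_ne h]
        exact hpos k hk
    · rw [hu q (by omega)]
      rcases Nat.lt_succ_iff_lt_or_eq.mp hq with h | rfl
      · rw [hm q h]
        exact evalMu_muDiff_congr (fun k hk => (hu k (by omega)).symm) b hb
      · rw [evalMu_muDiff _ q b hb hc rfl, he, Function.update_self, hu 0 (Nat.zero_le _), h₀,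
          posSum_congr hu]
  choose next hnext using step
  let init : S 0 := ⟨Function.update 0 0 κ, Function.update_self _ _ _, fun k hk => by
    rw [Function.update_of_ne hk.ne']
    exact zero_mem _, fun q hq => absurd hq (Nat.not_lt_zero q)⟩
  let s : ∀ n, S n := fun n => Nat.rec init next n
  have stab : ∀ k n, k ≤ n → (s n).1 k = (s k).1 k := by
    intro k n hkn
    induction n, hkn using Nat.le_induction with
    | base => rfl
    | succ n hn ih => exact (hnext n (s n) k hn).trans ih
  -- The diagonal family: the equation at `n` involves only indices up to `n + 1`, where the
  -- diagonal agrees with stage `n + 1`.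
  refine ⟨fun k => (s k).1 k, (s 0).2.1, fun k hk => (s k).2.2.1 k hk, fun n => ?_⟩
  refine (congrArg (Q.d hb) (stab n (n + 1) n.le_succ).symm).trans
    (((s (n + 1)).2.2.2 n n.lt_succ_self).trans ?_)
  exact evalMu_muDiff_congr (fun k hk => stab k (n + 1) hk) b hb

/-- If two solutions agree up to `n`, their equations at `n` show that the insertions of `κ` into `m
(n + 1) - m' (n + 1)` sum to zero, and injectivity on `Q₀` applies. -/
theorem IsCurved.family_unique (hQ : IsCurved Q κ Q₀) {b : ℤ} (hb : b + 1 = -1)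
    {m m' : ∀ n, Q.obj n (-1)} (h₀ : m 0 = κ) (h₀' : m' 0 = κ)
    (hpos : ∀ k, 0 < k → m k ∈ Q₀.carrier k (-1)) (hpos' : ∀ k, 0 < k → m' k ∈ Q₀.carrier k (-1))
    (hm : ∀ n, Q.d hb (m n) = (evalMu m).map (n := n) (a := b) (muDiff n b hb))
    (hm' : ∀ n, Q.d hb (m' n) = (evalMu m').map (n := n) (a := b) (muDiff n b hb)) : m = m' := by
  have hc : -1 + -1 = b := by omega
  obtain ⟨hcol⟩ := hQ.isCoproduct
  funext n
  induction n using Nat.strong_induction_on with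
  | _ n ih =>
    cases n with
    | zero => rw [h₀, h₀']
    | succ n =>
      have h := hm n
      rw [ih n n.lt_succ_self, hm' n, evalMu_muDiff m n b hb hc rfl, evalMu_muDiff m' n b hb hc rfl,
        posSum_congr fun k hk => ih k (Nat.lt_succ_of_le hk), neg_inj, add_left_inj, h₀, h₀'] at h
      refine sub_eq_zero.mp (eq_zero_of_sum_comp_kappa hcol rfl hc
        (sub_mem (hpos _ n.succ_pos) (hpos' _ n.succ_pos)) ?_)
      simp only [map_sub, AddMonoidHom.sub_apply, Finset.sum_sub_distrib, h, sub_self]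

end Existence

/-! ### The curved A-infinity operad is curved -/

theorem SubOperad.closure_le {Q : GrOperad.{u}} {s : ∀ (n : ℕ) (a : ℤ), Set (Q.obj n a)}
    {S : SubOperad Q} (h : ∀ n a, s n a ⊆ S.carrier n a) {n : ℕ} {a : ℤ} {x : Q.obj n a}
    (hx : x ∈ (SubOperad.closure s).carrier n a) : x ∈ S.carrier n a :=
  (AddSubgroup.mem_iInf.mp hx) ⟨S, h⟩

theorem SubOperad.subset_closure {Q : GrOperad.{u}} {s : ∀ (n : ℕ) (a : ℤ), Set (Q.obj n a)}
    {n : ℕ} {a : ℤ} {x : Q.obj n a} (hx : x ∈ s n a) :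
    x ∈ (SubOperad.closure s).carrier n a :=
  AddSubgroup.mem_iInf.mpr fun S => S.2 n a hx

/-- The preimage of a sub-operad. -/
def SubOperad.comap {P Q : GrOperad.{u}} (f : GrOperad.Hom P Q) (S : SubOperad Q) :
    SubOperad P where
  carrier n a := (S.carrier n a).comap f.map
  one_mem := by
    rw [AddSubgroup.mem_comap, f.map_one]
    exact S.one_mem
  comp_mem i hi hk hc x y hx hy := by
    rw [AddSubgroup.mem_comap, f.map_comp]
    exact S.comp_mem i hi hk hc hx hy

/-- The closure is an intersection, so there is no induction on expressions: instead, the equalizer,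
pushed forward to `Q`, is a sub-operad containing the generators. -/
theorem SubOperad.closure_hom_ext {Q R : GrOperad.{u}} {s : ∀ (n : ℕ) (a : ℤ), Set (Q.obj n a)}
    {f g : GrOperad.Hom (SubOperad.closure s).toOperad R}
    (h : ∀ {n : ℕ} {a : ℤ} (x : Q.obj n a) (hx : x ∈ s n a),
      f.map ⟨x, SubOperad.subset_closure hx⟩ = g.map ⟨x, SubOperad.subset_closure hx⟩) :
    f = g := by
  let E : SubOperad Q :=
    { carrier := fun n a =>
        ((f.map (n := n) (a := a)).eqLocus g.map).map
          ((SubOperad.closure s).carrier n a).subtype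
      one_mem := ⟨⟨Q.one, (SubOperad.closure s).one_mem⟩, f.map_one.trans g.map_one.symm, rfl⟩
      comp_mem := by
        rintro m n k a b c i hi hk hc _ _ ⟨x, hx, rfl⟩ ⟨y, hy, rfl⟩
        refine ⟨(SubOperad.closure s).toOperad.comp i hi hk hc x y, ?_, rfl⟩
        exact (f.map_comp i hi hk hc x y).trans
          ((congrArg₂ (fun x y => R.comp i hi hk hc x y) hx hy).trans
            (g.map_comp i hi hk hc x y).symm) }
  apply GrOperad.Hom.ext
  funext n a
  refine AddMonoidHom.ext fun x => ?_
  obtain ⟨y, hy, hyx⟩ := SubOperad.closure_le (S := E)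
    (fun n a x hx => ⟨⟨x, SubOperad.subset_closure hx⟩, h x hx, rfl⟩) x.2
  obtain rfl : y = x := Subtype.ext hyx
  exact hy

theorem mu_mem_cAInfPos {n : ℕ} (hn : 0 < n) : mu.{u} n ∈ cAInfPos.{u}.carrier n (-1) :=
  SubOperad.subset_closure ⟨hn, CAGen.mu n, rfl⟩

/-- The operad with one operation modulo two in every arity and degree. -/
def zmodTwoOperad : GrOperad.{u} where
  obj _ _ := ULift.{u} (ZMod 2)
  one := ⟨1⟩
  comp _ _ _ _ := AddMonoidHom.mk' (fun x => AddMonoidHom.mk' (fun y => ⟨x.down * y.down⟩)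
    (fun _ _ => ULift.ext _ _ (mul_add _ _ _)))
    (fun _ _ => AddMonoidHom.ext fun _ => ULift.ext _ _ (add_mul _ _ _))
  one_comp _ := ULift.ext _ _ (one_mul _)
  comp_one _ _ _ := ULift.ext _ _ (mul_one _)
  comp_assoc _ _ _ _ _ _ _ _ _ _ _ _ _ _ _ _ := ULift.ext _ _ (mul_assoc _ _ _)
  comp_parallel _ _ _ _ _ _ _ _ _ _ _ _ _ _ _ _ _ x y z := by
    -- Modulo two the Koszul signs disappear, and commutativity of multiplication suffices.
    have h : ∀ (e : ℤ) (t : ULift.{u} (ZMod 2)), ksign e • t = t := by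
      intro e t
      by_cases he : Even e
      · rw [ksign_of_even he, one_smul]
      · rw [ksign_of_not_even he, neg_smul, one_smul]
        exact ULift.ext _ _ (ZMod.neg_eq_self_mod_two _)
    rw [h]
    exact ULift.ext _ _ (mul_right_comm _ _ _)

/-- Nonvanishing in a quotient of formal expressions is detected by an evaluation that sends every
`μ_n` to `1`. -/
theorem mu_zero_ne_zero : mu.{u} 0 ≠ 0 := by
  intro h
  have h' : (⟨1⟩ : ULift.{u} (ZMod 2)) = 0 :=
    (congrArg ((evalMu (Q := zmodTwoOperad.{u}) fun _ => ⟨1⟩).map (n := 0) (a := -1)) h).trans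
      (map_zero _)
  exact one_ne_zero (congrArg ULift.down h')

/-- The sub-operad of the operations with at least one input, together with zero. -/
def positiveArity (Q : GrOperad.{u}) : SubOperad Q where
  carrier n _ := if n = 0 then ⊥ else ⊤
  one_mem := by simp
  comp_mem := by
    intro m n k a b c i hi hk hc x y _ hy
    by_cases h : k = 0
    -- A composite of arity `0` forces `m = 1` and `n = 0`, so the inserted factor is already zero.
    · rw [if_pos (by omega), AddSubgroup.mem_bot] at hy
      rw [hy, map_zero]
      exact zero_mem _
    · simp [h]

theorem mu_zero_notMem : mu.{u} 0 ∉ cAInfPos.{u}.carrier 0 (-1) := by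
  intro h
  have h' := SubOperad.closure_le (S := positiveArity cAInf.{u}.toGrOperad) (fun n a x hx => by
    simp [positiveArity, hx.1.ne']) h
  exact mu_zero_ne_zero h'

/-- The family with value `k` in arity `0` and `f μ_n` in positive arities. -/
def extendFamily {R : GrOperad.{u}} (f : GrOperad.Hom cAInfPos.{u}.toOperad R) (k : R.obj 0 (-1)) :
    ∀ n, R.obj n (-1)
  | 0 => k
  | n + 1 => f.map ⟨mu (n + 1), mu_mem_cAInfPos n.succ_pos⟩

/-- The generators divide into `μ_0` and the `μ_n` with `n > 0`. Freeness of the positive part is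
not needed: a morphism out of it is determined by its values on generators, and these values extend
to all of `cAInf`. -/
theorem cAInf_isCoproduct : Nonempty (Limits.IsColimit
    (Limits.BinaryCofan.mk cAInfPos.{u}.incl (kappaHom cAInf.{u}.toGrOperad (mu 0)))) := by
  refine ⟨Limits.BinaryCofan.IsColimit.mk _
    (fun {R} f g => evalMu (extendFamily f (GrOperad.Hom.map g (FreeOperad.gen KGen.kappa))))
    (fun {R} f g => ?_) (fun {R} f g => ?_) (fun {R} f g l h₁ h₂ => ?_)⟩
  · refine SubOperad.closure_hom_ext fun {n a} x hx => ?_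
    obtain ⟨hn, y, rfl⟩ := hx
    cases y
    cases n with
    | zero => exact absurd hn (lt_irrefl 0)
    | succ n => rfl
  · refine FreeOperad.hom_ext fun x => ?_
    cases x
    rfl
  · refine FreeOperad.hom_ext fun {n a} x => ?_
    cases x
    cases n with
    | zero =>
      exact congrArg (fun G : GrOperad.Hom kappaOperad R => G.map (FreeOperad.gen KGen.kappa)) h₂
    | succ n =>
      exact congrArg (fun G : GrOperad.Hom cAInfPos.toOperad R =>
        G.map ⟨mu (n + 1), mu_mem_cAInfPos n.succ_pos⟩) h₁

theorem comp_mem_weightPart {Q : GrOperad.{u}} {κ : Q.obj 0 (-1)} {Q₀ : SubOperad Q}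
    {v w m n k : ℕ} {a b c : ℤ} (i : ℕ) (hi : i < m) (hk : m + n = k + 1) (hc : a + b = c)
    {x : Q.obj m a} {y : Q.obj n b} (hx : x ∈ weightPart κ Q₀ v m a)
    (hy : y ∈ weightPart κ Q₀ w n b) : Q.comp i hi hk hc x y ∈ weightPart κ Q₀ (v + w) k c := by
  induction hx using AddSubgroup.closure_induction with
  | mem x hx =>
    induction hy using AddSubgroup.closure_induction with
    | mem y hy => exact AddSubgroup.subset_closure (IsMonomial.comp i hi hk hc hx hy)
    | zero => rw [map_zero]; exact zero_mem _
    | add y y' _ _ h h' => rw [map_add]; exact add_mem h h'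
    | neg y _ h => rw [map_neg]; exact neg_mem h
  | zero => rw [map_zero]; exact zero_mem _
  | add x x' _ _ h h' => rw [map_add]; exact add_mem h h'
  | neg x _ h => rw [map_neg]; exact neg_mem h

/-! ### Derivations and the weight grading -/

section Weight

variable (δ : ∀ {n : ℕ} {a : ℤ}, CAGen.{u} n a → ∀ b : ℤ, b + 1 = a → FreeObj CAGen.{u} n b)

/-- The weight grading of the curved A-infinity operad. -/
abbrev cAInfWeight (w n : ℕ) (a : ℤ) : AddSubgroup (cAInf.{u}.obj n a) :=
  weightPart (Q := cAInf.{u}.toGrOperad) (mu 0) cAInfPos w n a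

variable {δ} {s : ℕ}
  (hpos : ∀ (n : ℕ) (b : ℤ) (hb : b + 1 = -1), 0 < n → δ (CAGen.mu n) b hb ∈ cAInfWeight s n b)

include hpos in
-- By the Leibniz rule it suffices to control generators. The shift `s` is kept general so that `s =
-- 0` and `s = 1` serve the two parts of the differential.
theorem deriv_mem_weightPart_of_mem {n : ℕ} {a : ℤ} {x : FreeObj CAGen.{u} n a}
    (hx : x ∈ cAInfPos.{u}.carrier n a) {b : ℤ} (h : b + 1 = a) :
    FreeObj.deriv δ h x ∈ cAInfWeight s n b := by
  let D : cAInf.{u}.toGrOperad.LowerMap := FreeObj.deriv δ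
  -- Membership in `cAInfPos` is part of the condition, because the undifferentiated factor must
  -- have weight zero.
  let S : SubOperad cAInf.{u}.toGrOperad :=
    { carrier := fun n a =>
        { carrier := {x | x ∈ cAInfPos.carrier n a ∧
            ∀ (b : ℤ) (h : b + 1 = a), D h x ∈ cAInfWeight s n b}
          zero_mem' := ⟨zero_mem _, fun b h => by rw [map_zero]; exact zero_mem _⟩
          add_mem' := fun hx hy => ⟨add_mem hx.1 hy.1, fun b h => by
            rw [map_add]; exact add_mem (hx.2 b h) (hy.2 b h)⟩
          neg_mem' := fun hx => ⟨neg_mem hx.1, fun b h => by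
            rw [map_neg]; exact neg_mem (hx.2 b h)⟩ }
      one_mem := ⟨cAInfPos.one_mem, fun b h => zero_mem (cAInfWeight s 1 b)⟩
      comp_mem := by
        rintro m n k a b c i hi hk hc x y ⟨hx, hx'⟩ ⟨hy, hy'⟩
        refine ⟨cAInfPos.comp_mem i hi hk hc hx hy, fun c' h => ?_⟩
        have e := FreeObj.deriv_comp δ i hi hk hc (a' := a - 1) (b' := b - 1) (by omega) (by omega)
          h (by omega) (by omega) x y
        refine (congrArg (· ∈ cAInfWeight s k c') e).mpr (add_mem ?_ (zsmul_mem ?_ _))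
        · exact comp_mem_weightPart (v := s) (w := 0) _ _ _ _ (hx' (a - 1) (by omega))
            (AddSubgroup.subset_closure (IsMonomial.base hy))
        · have := comp_mem_weightPart (v := 0) (w := s) i hi hk (show a + (b - 1) = c' by omega)
            (AddSubgroup.subset_closure (IsMonomial.base hx)) (hy' (b - 1) (by omega))
          rwa [zero_add] at this }
  have hS : x ∈ S.carrier n a := by
    refine SubOperad.closure_le (fun n a x hx => ?_) hx
    refine ⟨SubOperad.subset_closure hx, ?_⟩
    obtain ⟨hn, y, rfl⟩ := hx
    cases y
    exact fun b h => hpos n b h hn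
  exact hS.2 b h

variable
  (hzero : ∀ (b : ℤ) (hb : b + 1 = -1), δ (CAGen.mu 0) b hb ∈ cAInfWeight (1 + s) 0 b)

include hpos hzero

theorem deriv_mem_weightPart_of_isMonomial {w n : ℕ} {a : ℤ} {x : cAInf.{u}.obj n a}
    (hx : IsMonomial (Q := cAInf.{u}.toGrOperad) (mu 0) cAInfPos w x) {b : ℤ} (h : b + 1 = a) :
    FreeObj.deriv δ h x ∈ cAInfWeight (w + s) n b := by
  induction hx generalizing b with
  | base hx =>
    rw [zero_add]
    exact deriv_mem_weightPart_of_mem hpos hx h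
  | kappa => exact hzero b h
  | @comp v w m n k a₁ a₂ a₃ i hi hk hc x y hx hy ihx ihy =>
    have e := FreeObj.deriv_comp δ i hi hk hc (a' := a₁ - 1) (b' := a₂ - 1)
      (by omega) (by omega) h (by omega) (by omega) x y
    refine (congrArg (· ∈ cAInfWeight (v + w + s) k b) e).mpr (add_mem ?_ (zsmul_mem ?_ _))
    · rw [add_right_comm]
      exact comp_mem_weightPart _ _ _ _ (ihx _) (AddSubgroup.subset_closure hy)
    · rw [add_assoc]
      exact comp_mem_weightPart _ _ _ _ (AddSubgroup.subset_closure hx) (ihy _)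

theorem deriv_mem_weightPart {w n : ℕ} {a b : ℤ} (h : b + 1 = a) {x : cAInf.{u}.obj n a}
    (hx : x ∈ cAInfWeight w n a) : FreeObj.deriv δ h x ∈ cAInfWeight (w + s) n b := by
  let D : cAInf.{u}.toGrOperad.LowerMap := FreeObj.deriv δ
  have hle : cAInfWeight w n a ≤ (cAInfWeight (w + s) n b).comap (D h) :=
    (AddSubgroup.closure_le _).mpr fun _ hy => deriv_mem_weightPart_of_isMonomial hpos hzero hy h
  exact hle hx

end Weight

theorem FreeObj.deriv_add {X : ℕ → ℤ → Type u}
    {δ δ₀ δ₁ : ∀ {n : ℕ} {a : ℤ}, X n a → ∀ b : ℤ, b + 1 = a → FreeObj X n b}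
    (hδ : ∀ {n : ℕ} {a : ℤ} (x : X n a) (b : ℤ) (hb : b + 1 = a),
      δ x b hb = δ₀ x b hb + δ₁ x b hb) {n : ℕ} {a b : ℤ} (h : b + 1 = a) (x : FreeObj X n a) :
    FreeObj.deriv δ h x = FreeObj.deriv δ₀ h x + FreeObj.deriv δ₁ h x := by
  induction x using FreeObj.ind with
  | h x =>
    induction x generalizing b with
    | gen x => exact hδ x b h
    | one => exact (add_zero 0).symm
    | @comp m n k a₁ a₂ a₃ i hi hk hc x y ihx ihy =>
      simp only [FreeObj.mk_comp, FreeObj.deriv_comp _ i hi hk hc (sub_add_cancel a₁ 1)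
        (sub_add_cancel a₂ 1) h (by omega) (by omega), ihx, ihy, map_add, AddMonoidHom.add_apply,
        smul_add]
      abel
    | zero => simp only [FreeObj.mk_zero, map_zero, add_zero]
    | add x y ihx ihy =>
      simp only [FreeObj.mk_add, map_add, ihx, ihy]
      abel
    | neg x ihx =>
      simp only [FreeObj.mk_neg, map_neg, ihx]
      abel

/-- The terms of `d μ_n` in which `μ_0` is inserted into `μ_{n+1}`. -/
def muDiffZero (n : ℕ) (b : ℤ) (hb : b + 1 = -1) : FreeObj CAGen.{u} n b :=
  - ∑ p : Fin (n + 1), FreeObj.comp (p : ℕ) p.2 (Nat.add_zero _) (by omega) (mu (n + 1)) (mu 0)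

/-- The terms of `d μ_n` in which an operation of positive arity is inserted. -/
def muDiffPos (n : ℕ) (b : ℤ) (hb : b + 1 = -1) : FreeObj CAGen.{u} n b :=
  - posSum (Q := FreeOperad CAGen.{u}) mu n (by omega)

theorem muDiff_eq_add (n : ℕ) (b : ℤ) (hb : b + 1 = -1) :
    muDiff.{u} n b hb = muDiffZero n b hb + muDiffPos n b hb := by
  rw [muDiff, Fin.sum_univ_succ, neg_add]
  rfl

theorem muDiffZero_mem (n : ℕ) (b : ℤ) (hb : b + 1 = -1) :
    muDiffZero.{u} n b hb ∈ cAInfWeight 1 n b :=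
  neg_mem (sum_mem fun _ _ => comp_mem_weightPart (v := 0) (w := 1) _ _ _ _
    (AddSubgroup.subset_closure (IsMonomial.base (mu_mem_cAInfPos n.succ_pos)))
    (AddSubgroup.subset_closure IsMonomial.kappa))

theorem muDiffPos_mem (n : ℕ) (b : ℤ) (hb : b + 1 = -1) :
    muDiffPos.{u} n b hb ∈ cAInfWeight 0 n b :=
  neg_mem (AddSubgroup.subset_closure (IsMonomial.base
    (posSum_mem (Q₀ := cAInfPos) (fun _ => mu_mem_cAInfPos) n _)))

/-- The values on generators of the part of the differential that preserves the weight. -/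
def caGenDiffZero : ∀ {n : ℕ} {a : ℤ}, CAGen.{u} n a → ∀ b : ℤ, b + 1 = a →
    FreeObj CAGen.{u} n b
  -- Since `μ_0` has weight one, `d μ_0 = - μ_1 ∘ μ_0` preserves the weight and belongs entirely to
  -- `d₀`; for `n > 0` the insertions of `μ_0` raise it.
  | 0, _, .mu _, b, hb => muDiffZero 0 b hb
  | n + 1, _, .mu _, b, hb => muDiffPos (n + 1) b hb

/-- The values on generators of the part of the differential that raises the weight by one. -/
def caGenDiffOne : ∀ {n : ℕ} {a : ℤ}, CAGen.{u} n a → ∀ b : ℤ, b + 1 = a →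
    FreeObj CAGen.{u} n b
  | 0, _, .mu _, _, _ => 0
  | n + 1, _, .mu _, b, hb => muDiffZero (n + 1) b hb

theorem caGenDiff_eq_add {n : ℕ} {a : ℤ} (x : CAGen.{u} n a) (b : ℤ) (hb : b + 1 = a) :
    caGenDiff x b hb = caGenDiffZero x b hb + caGenDiffOne x b hb := by
  cases x
  cases n with
  | zero =>
    refine (muDiff_eq_add 0 b hb).trans (congrArg (muDiffZero 0 b hb + ·) ?_)
    simp only [muDiffPos, posSum, caGenDiffOne, Finset.univ_eq_empty, Finset.sum_empty]
    exact neg_zero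
  | succ n => exact (muDiff_eq_add (n + 1) b hb).trans (add_comm _ _)

theorem cAInf_isCurved : IsCurved cAInf.{u} (mu 0) cAInfPos where
  kappa_notMem := mu_zero_notMem
  isCoproduct := cAInf_isCoproduct
  strictMixed := by
    refine ⟨FreeObj.deriv caGenDiffZero, FreeObj.deriv caGenDiffOne,
      fun h x => FreeObj.deriv_add caGenDiff_eq_add h x, fun h w x hx => ?_, fun h w x hx => ?_,
      fun h => rfl⟩
    · refine deriv_mem_weightPart (s := 0) (fun n b hb hn => ?_) (fun b hb => ?_) h hx
      · cases n with
        | zero => exact absurd hn (lt_irrefl 0)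
        | succ n => exact muDiffPos_mem (n + 1) b hb
      · exact muDiffZero_mem 0 b hb
    · refine deriv_mem_weightPart (s := 1) (fun n b hb hn => ?_) (fun b hb => ?_) h hx
      · cases n with
        | zero => exact absurd hn (lt_irrefl 0)
        | succ n => exact muDiffZero_mem (n + 1) b hb
      · exact zero_mem _

/-! ### Initiality -/

theorem hom_eq_evalMu {Q : GrOperad.{u}} (f : GrOperad.Hom (FreeOperad CAGen.{u}) Q) :
    f = evalMu fun n => f.map (n := n) (a := -1) (mu n) :=
  FreeOperad.hom_ext fun x => by cases x; rfl

/-- The object of `Curv` given by the curved A-infinity operad. -/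
abbrev cAInfCurv (h : IsCurved cAInf.{u} (mu 0) cAInfPos) : Curv.{u} :=
  ⟨cAInf, mu 0, cAInfPos, h⟩

theorem exists_curvHom (h : IsCurved cAInf.{u} (mu 0) cAInfPos) (C : Curv.{u}) :
    Nonempty (cAInfCurv h ⟶ C) := by
  obtain ⟨m, h₀, hpos, hm⟩ := C.isCurved.exists_family (b := -2) (by norm_num)
  have hm' : ∀ (n : ℕ) (b : ℤ) (hb : b + 1 = -1),
      C.Q.d hb (m n) = (evalMu m).map (n := n) (a := b) (muDiff n b hb) := by
    intro n b hb
    obtain rfl : b = -2 := by omega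
    exact hm n
  let F : Curv.Hom (cAInfCurv h) C :=
    { map := (evalMu m).map
      map_one := (evalMu m).map_one
      map_comp := (evalMu m).map_comp
      map_d := fun hb x => evalMu_deriv hm' hb x
      map_kappa := h₀
      map_mem := fun x hx => by
        refine SubOperad.closure_le (S := SubOperad.comap (evalMu m) C.Q₀)
          (fun n a y hy => ?_) hx
        obtain ⟨hn, g, rfl⟩ := hy
        cases g
        exact hpos n hn }
  exact ⟨F⟩

/-- Freeness reduces equality to the values on the `μ_n`. Compatibility with `d`, `κ` and `Q₀` makes
both families of values solutions of the recursion. -/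
theorem curvHom_ext (h : IsCurved cAInf.{u} (mu 0) cAInfPos) (C : Curv.{u})
    (f g : Curv.Hom (cAInfCurv h) C) : f = g := by
  have hb : (-2 : ℤ) + 1 = -1 := by norm_num
  have hd : ∀ (f : Curv.Hom (cAInfCurv h) C) (n : ℕ),
      C.Q.d hb (f.map (n := n) (a := -1) (mu n)) =
        (evalMu fun n => f.map (n := n) (a := -1) (mu n)).map (n := n) (a := -2)
          (muDiff n (-2) hb) := by
    intro f n
    refine (f.map_d hb (mu n)).symm.trans ?_
    exact congrArg (fun F : GrOperad.Hom (FreeOperad CAGen.{u}) C.Q.toGrOperad =>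
      F.map (n := n) (a := -2) (muDiff n (-2) hb)) (hom_eq_evalMu f.toGrHom)
  have hfg := C.isCurved.family_unique hb (m := fun n => f.map (n := n) (a := -1) (mu n))
    (m' := fun n => g.map (n := n) (a := -1) (mu n)) f.map_kappa g.map_kappa
    (fun k hk => f.map_mem _ (mu_mem_cAInfPos hk)) (fun k hk => g.map_mem _ (mu_mem_cAInfPos hk))
    (hd f) (hd g)
  have hF : f.toGrHom = g.toGrHom :=
    (hom_eq_evalMu f.toGrHom).trans ((congrArg evalMu hfg).trans (hom_eq_evalMu g.toGrHom).symm)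
  apply Curv.Hom.ext
  exact congrArg (fun F : GrOperad.Hom (FreeOperad CAGen.{u}) C.Q.toGrOperad => @F.map) hF

end CurvedOperad

/-- The quadruple `(cA∞, d, μ_0, ⟨μ_i⟩_{i>0})` is an object of `Curv`, and it is initial there. -/
theorem theorem1p2 :
    ∃ h : CurvedOperad.IsCurved CurvedOperad.cAInf.{u} (CurvedOperad.mu 0) CurvedOperad.cAInfPos,
      Nonempty (CategoryTheory.Limits.IsInitial
        (⟨CurvedOperad.cAInf, CurvedOperad.mu 0, CurvedOperad.cAInfPos, h⟩ :
          CurvedOperad.Curv.{u})) :=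
  ⟨CurvedOperad.cAInf_isCurved, ⟨CategoryTheory.Limits.IsInitial.ofUniqueHom
    (fun C => (CurvedOperad.exists_curvHom CurvedOperad.cAInf_isCurved C).some)
    (fun C _ => CurvedOperad.curvHom_ext CurvedOperad.cAInf_isCurved C _ _)⟩⟩
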